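/- **Theorem (Improved hidden-cut algorithm).** Let $\epsilon\in(0,1]$ and $n\ge 1$. In the *hidden many-cut problem* one is given copies of an unknown $n$-qubit state vector $|\psi\rangle$ with the promise that $|\psi\rangle=\bigotimes_{k=1}^m|\phi_k\rangle_{C_k}$ for some partition $[n]=C_1\sqcup\dots\sqcup C_m$ into nonempty blocks, where each $|\phi_k\rangle$ is a state vector on the qubits of $C_k$ whose trace distance $\tfrac12\||\phi_k\rangle\langle\phi_k|-|\chi\rangle\langle\chi|\|_1$ from every multipartite product state vector $|\chi\rangle$ (a tensor product of state vectors over at least two nonempty groups of the qubits of $C_k$) is at least $\epsilon$. The task is to output the partition. There is a non-adaptive algorithm that solves it in polynomial time with $O(n/\epsilon^2)$ copies and with circuits of constant depth on two copies at a time, without auxiliary qubits. In detail: 1. *Measurement.* For each $n$, on the $2n$ qubits of two copies, the circuit consisting of one layer of CNOT gates (from qubit $i$ of the first copy to qubit $i$ of the second, for each $i$) and one layer of Hadamard gates (on the first copy), followed by a computational-basis measurement, has depth $2$ and is exactly the measurement in the $n$-fold Bell basis. For $y\in\mathbb Z_2^n$, the sum of the effects of those Bell outcomes that are the singlet exactly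 at the positions $i$ with $y_i=1$ equals the effect $\Pi_y=2^{-n}\sum_{x\in\mathbb Z_2^n}(-1)^{y\cdot x}\bigotimes_{i=1}^n\mathrm{SWAP}^{x_i}$ of the character POVM of the SWAP representation of $\mathbb Z_2^n$. 2. *Purity gap.* If $|\psi\rangle$ satisfies the promise and $\psi_S$ denotes its reduced state on $S\subseteq[n]$, then $\operatorname{tr}\psi_S^2=1$ if $S$ is a union of blocks $C_i$ (possibly empty), and $\operatorname{tr}\psi_S^2\le 1-\epsilon^2$ otherwise. 3. *Algorithm.* There are a single classical program (for a unit-cost random access machine with addition and truncated subtraction), constants $c,C$ and a polynomial $p$ such that the following holds. The input of the program is $n$, $T$ and the outcomes of $T$ independent rounds of the measurement in 1, each on two fresh copies of $|\psi\rangle$; it always halts, and the total number of gates, single-qubit measurements and classical steps is at most $p(n+T)$. For all $n\ge1$, $\epsilon\in(0,1]$ and $\delta\in(0,1)$, with $T=\lceil c\,(n+\log(1/\delta))/\epsilon^2\rceil$ the number of copies satisfies $2T\le C\,(n+\log(1/\delta))/\epsilon^2$ (so it is $O(n/\epsilon^2)$ for fixed $\delta$), and for every $|\psi\rangle$ that satisfies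 the promise the output is the partition $\{C_1,\dots,C_m\}$ with probability at least $1-\delta$. -/

import Mathlib

open scoped Matrix BigOperators

noncomputable section

namespace HiddenCut

/-! ### State vectors, product states, trace distance, reduced states -/

/-- Amplitudes, in the computational basis, of a vector in the Hilbert space of qubits labelled
by `ι`. -/
abbrev Amp (ι : Type) := (ι → Bool) → ℂ

section States

variable {ι : Type} [Fintype ι] [DecidableEq ι]

/-- Unit vectors. -/
def IsStateVector (ψ : Amp ι) : Prop := ∑ s, ‖ψ s‖ ^ 2 = 1

/-- The tensor product of the factors `φ B` over the blocks `B` of the set partition `P`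
(values of `φ` on sets that are not blocks play no role). -/
def IsProductOver (P : Finpartition (Finset.univ : Finset ι)) (ψ : Amp ι)
    (φ : (B : Finset ι) → Amp B) : Prop :=
  ∀ s, ψ s = ∏ B ∈ P.parts, φ B (fun i => s i)

/-- A multipartite product state: a tensor product of state vectors over at least two
(nonempty, disjoint) groups of qubits. -/
def IsMultipartiteProduct (χ : Amp ι) : Prop :=
  ∃ (P : Finpartition (Finset.univ : Finset ι)) (φ : (B : Finset ι) → Amp B),
    2 ≤ P.parts.card ∧ (∀ B ∈ P.parts, IsStateVector (φ B)) ∧ IsProductOver P χ φ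

/-- The rank-one operator `|ψ⟩⟨ψ|`. -/
def ketbra (ψ : Amp ι) : Matrix (ι → Bool) (ι → Bool) ℂ := Matrix.vecMulVec ψ (star ψ)

/-- The trace norm: the sum of the singular values, which are the square roots of the
eigenvalues of `Mᴴ * M`. -/
def traceNorm {I : Type} [Fintype I] [DecidableEq I] (M : Matrix I I ℂ) : ℝ :=
  ∑ i, √((Matrix.isHermitian_conjTranspose_mul_self M).eigenvalues i)

/-- Trace distance of the pure states given by two vectors. -/
def traceDist (φ χ : Amp ι) : ℝ := (1 / 2) * traceNorm (ketbra φ - ketbra χ)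

/-- The bit string on all qubits that is `a` on `S` and `b` off `S`. -/
def glue (S : Finset ι) (a : {i // i ∈ S} → Bool) (b : {i // i ∉ S} → Bool) : ι → Bool :=
  fun i => if h : i ∈ S then a ⟨i, h⟩ else b ⟨i, h⟩

/-- The reduced state on `S`: the partial trace of `|ψ⟩⟨ψ|` over the qubits outside `S`. -/
def reduced (ψ : Amp ι) (S : Finset ι) :
    Matrix ({i // i ∈ S} → Bool) ({i // i ∈ S} → Bool) ℂ :=
  fun a a' => ∑ b : {i // i ∉ S} → Bool, ketbra ψ (glue S a b) (glue S a' b)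

/-- The purity `tr (ψ_S ^ 2)`. -/
def purity (ψ : Amp ι) (S : Finset ι) : ℝ := ((reduced ψ S * reduced ψ S).trace).re

end States

/-- The promise of the hidden many-cut problem with parameter `ε` and hidden partition `P`. -/
def IsHiddenManyCut {n : ℕ} (ε : ℝ) (ψ : Amp (Fin n))
    (P : Finpartition (Finset.univ : Finset (Fin n))) : Prop :=
  IsStateVector ψ ∧ ∃ φ : (B : Finset (Fin n)) → Amp B, IsProductOver P ψ φ ∧
    ∀ B ∈ P.parts, IsStateVector (φ B) ∧
      ∀ χ : Amp B, IsMultipartiteProduct χ → ε ≤ traceDist (φ B) χ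

/-! ### Quantum circuits -/

section Circuits

variable {Q : Type} [Fintype Q] [DecidableEq Q]

/-- Hadamard gates and controlled-NOT gates on qubits labelled by `Q`. -/
inductive Gate (Q : Type) : Type
  | hadamard (q : Q) : Gate Q
  | cnot (control target : Q) (h : control ≠ target) : Gate Q

/-- The qubits on which a gate acts. -/
def Gate.support : Gate Q → Finset Q
  | .hadamard q => {q}
  | .cnot c t _ => {c, t}

/-- The unitary on all qubits in `Q` that a gate performs. -/
def Gate.matrix : Gate Q → Matrix (Q → Bool) (Q → Bool) ℂ
  | .hadamard q => fun s u =>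
      if ∀ r, r ≠ q → s r = u r then (if s q && u q then -1 else 1) / (√2 : ℝ) else 0
  | .cnot c t _ => fun s u => if s = Function.update u t (xor (u t) (u c)) then 1 else 0

/-- A layer: gates that act on pairwise disjoint sets of qubits, performed in parallel. -/
structure Layer (Q : Type) [DecidableEq Q] where
  gates : List (Gate Q)
  disjoint : gates.Pairwise fun g g' => Disjoint g.support g'.support

/-- A circuit: a list of layers, the first one being performed first. -/
structure Circuit (Q : Type) [DecidableEq Q] where
  layers : List (Layer Q)

def Layer.matrix (L : Layer Q) : Matrix (Q → Bool) (Q → Bool) ℂ :=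
  (L.gates.map Gate.matrix).prod

def Circuit.matrix (K : Circuit Q) : Matrix (Q → Bool) (Q → Bool) ℂ :=
  (K.layers.map Layer.matrix).reverse.prod

def Circuit.depth (K : Circuit Q) : ℕ := K.layers.length

/-- The number of gates. -/
def Circuit.size (K : Circuit Q) : ℕ := (K.layers.map fun L => L.gates.length).sum

/-- Probability of the outcome `s` when all qubits of `Ψ` are measured in the computational basis
after the circuit. -/
def Circuit.prob (K : Circuit Q) (Ψ : Amp Q) (s : Q → Bool) : ℝ := ‖(K.matrix *ᵥ Ψ) s‖ ^ 2

/-- The measurement effect `U† |s⟩⟨s| U` of the outcome `s`, for the unitary `U` of the circuit. -/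
def Circuit.effect (K : Circuit Q) (s : Q → Bool) : Matrix (Q → Bool) (Q → Bool) ℂ :=
  K.matrixᴴ * Matrix.single s s 1 * K.matrix

end Circuits

/-! ### Bell sampling and the character POVM -/

/-- Labels of the qubits of two copies of an `n`-qubit register; `(c, i)` is qubit `i` of
copy `c`. -/
abbrev TwoCopies (n : ℕ) := Fin 2 × Fin n

/-- The vector `ψ ⊗ ψ`. -/
def twoCopies {n : ℕ} (ψ : Amp (Fin n)) : Amp (TwoCopies n) :=
  fun s => ψ (fun i => s (0, i)) * ψ (fun i => s (1, i))

/-- The circuit that acts on the `2 * n` qubits of the two copies only: controlled-NOTs from each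
qubit of the first copy to its partner in the second copy, then Hadamards on the first copy. -/
def bellCircuit (n : ℕ) : Circuit (TwoCopies n) where
  layers :=
    [{ gates := (List.finRange n).map fun i => .cnot (0, i) (1, i) (by simp)
       disjoint := by
         rw [List.pairwise_map]
         refine (List.nodup_finRange n).imp ?_
         intro i j hij
         simp [Gate.support, Ne.symm hij] },
     { gates := (List.finRange n).map fun i => .hadamard (0, i)
       disjoint := by
         rw [List.pairwise_map]
         refine (List.nodup_finRange n).imp ?_
         intro i j hij
         simp [Gate.support, hij] }]

/-- The Bell states `(|0,b⟩ + (-1)^a |1,1-b⟩) / √2`, with their amplitude at `|u,v⟩`: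
`(a, b) = (1, 1)` is the singlet, the other three are the triplets. -/
def bell (a b u v : Bool) : ℂ :=
  if v = xor u b then (if a && u then -1 else 1) / (√2 : ℝ) else 0

/-- The multi-qubit Bell basis: the Bell state with label `(s (0, i), s (1, i))` on the two copies
of qubit `i`, for each `i`. -/
def bellBasis {n : ℕ} (s : TwoCopies n → Bool) : Amp (TwoCopies n) :=
  fun u => ∏ i, bell (s (0, i)) (s (1, i)) (u (0, i)) (u (1, i))

/-- The positions where a Bell outcome is the singlet. -/
def singletPattern {n : ℕ} (s : TwoCopies n → Bool) : Fin n → ZMod 2 :=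
  fun i => if s (0, i) && s (1, i) then 1 else 0

/-- The SWAP of two qubits. -/
def swapGate : Matrix (Bool × Bool) (Bool × Bool) ℂ := fun s u => if s = u.swap then 1 else 0

/-- The representation `x ↦ ⨂ᵢ SWAP ^ xᵢ` of `ℤ₂ⁿ` on two copies. -/
def swapRep {n : ℕ} (x : Fin n → ZMod 2) :
    Matrix (TwoCopies n → Bool) (TwoCopies n → Bool) ℂ :=
  fun s u => ∏ i, (swapGate ^ (x i).val) (s (0, i), s (1, i)) (u (0, i), u (1, i))

/-- The characters `χ_y (x) = (-1) ^ (y ⬝ x)` of `ℤ₂ⁿ`. -/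
def character {n : ℕ} (y x : Fin n → ZMod 2) : ℂ := (-1) ^ (y ⬝ᵥ x).val

/-- The character POVM `Π_y = |G|⁻¹ ∑ₓ conj (χ_y x) R x` of the SWAP representation. -/
def characterPOVM {n : ℕ} (y : Fin n → ZMod 2) :
    Matrix (TwoCopies n → Bool) (TwoCopies n → Bool) ℂ :=
  (1 / 2 ^ n : ℂ) • ∑ x : Fin n → ZMod 2, star (character y x) • swapRep x

/-! ### Classical computation

Structured programs for a unit-cost random access machine over the natural numbers, with registers
and a memory of rows and columns. Addition and truncated subtraction are the only arithmetic (so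
that in `k` steps words grow by at most `k` bits). -/

/-- The memory of the machine. -/
structure Store where
  reg : ℕ → ℕ
  cell : ℕ → ℕ → ℕ

/-- Programs; all parameters are names of registers, except for the constant `v`. -/
inductive Prog : Type
  | const (d v : ℕ)
  | add (d a b : ℕ)
  | sub (d a b : ℕ)
  | load (d r c : ℕ)
  | store (r c a : ℕ)
  | seq (p q : Prog)
  | ite (a : ℕ) (p q : Prog)
  | loop (a : ℕ) (p : Prog)

/-- `σ` with the register `d` set to `v`. -/
def Store.setReg (σ : Store) (d v : ℕ) : Store := { σ with reg := Function.update σ.reg d v }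

/-- `σ` with the cell in row `r` and column `c` set to `v`. -/
def Store.setCell (σ : Store) (r c v : ℕ) : Store :=
  { σ with cell := Function.update σ.cell r (Function.update (σ.cell r) c v) }

/-- `Exec p σ σ' k`: started in `σ`, the program `p` halts in `σ'` after exactly `k` steps.
Every elementary instruction and every test of a register for zero is one step. -/
inductive Exec : Prog → Store → Store → ℕ → Prop
  | const (σ d v) : Exec (.const d v) σ (σ.setReg d v) 1
  | add (σ d a b) : Exec (.add d a b) σ (σ.setReg d (σ.reg a + σ.reg b)) 1
  | sub (σ d a b) : Exec (.sub d a b) σ (σ.setReg d (σ.reg a - σ.reg b)) 1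
  | load (σ d r c) : Exec (.load d r c) σ (σ.setReg d (σ.cell (σ.reg r) (σ.reg c))) 1
  | store (σ r c a) : Exec (.store r c a) σ (σ.setCell (σ.reg r) (σ.reg c) (σ.reg a)) 1
  | seq {p q σ σ' σ'' k l} : Exec p σ σ' k → Exec q σ' σ'' l → Exec (.seq p q) σ σ'' (k + l)
  | iteTrue {a p q σ σ' k} : σ.reg a ≠ 0 → Exec p σ σ' k → Exec (.ite a p q) σ σ' (k + 1)
  | iteFalse {a p q σ σ' k} : σ.reg a = 0 → Exec q σ σ' k → Exec (.ite a p q) σ σ' (k + 1)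
  | loopStop {a p σ} : σ.reg a = 0 → Exec (.loop a p) σ σ 1
  | loopStep {a p σ σ' σ'' k l} : σ.reg a ≠ 0 → Exec p σ σ' k → Exec (.loop a p) σ' σ'' l →
      Exec (.loop a p) σ σ'' (k + l + 1)

/-- The machine is deterministic. -/
theorem Exec.deterministic {p : Prog} {σ σ₁ σ₂ : Store} {k₁ k₂ : ℕ}
    (h₁ : Exec p σ σ₁ k₁) (h₂ : Exec p σ σ₂ k₂) : σ₁ = σ₂ ∧ k₁ = k₂ := by
  induction h₁ generalizing σ₂ k₂ with
  | const | add | sub | load | store => cases h₂; exact ⟨rfl, rfl⟩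
  | seq _ _ ih₁ ih₂ =>
    cases h₂ with
    | seq h h' =>
      obtain ⟨rfl, rfl⟩ := ih₁ h
      obtain ⟨rfl, rfl⟩ := ih₂ h'
      exact ⟨rfl, rfl⟩
  | iteTrue h0 _ ih =>
    cases h₂ with
    | iteTrue _ h =>
      obtain ⟨rfl, rfl⟩ := ih h
      exact ⟨rfl, rfl⟩
    | iteFalse h _ => exact absurd h h0
  | iteFalse h0 _ ih =>
    cases h₂ with
    | iteTrue h _ => exact absurd h0 h
    | iteFalse _ h =>
      obtain ⟨rfl, rfl⟩ := ih h
      exact ⟨rfl, rfl⟩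
  | loopStop h0 =>
    cases h₂ with
    | loopStop _ => exact ⟨rfl, rfl⟩
    | loopStep h _ _ => exact absurd h0 h
  | loopStep h0 _ _ ih₁ ih₂ =>
    cases h₂ with
    | loopStop h => exact absurd h h0
    | loopStep _ h h' =>
      obtain ⟨rfl, rfl⟩ := ih₁ h
      obtain ⟨rfl, rfl⟩ := ih₂ h'
      exact ⟨rfl, rfl⟩

/-! ### The algorithm: `T` independent rounds of Bell sampling, then a classical program -/

/-- The outcomes of `T` rounds, each of which measures the `2 * n` qubits of two fresh copies. -/
abbrev Outcomes (n T : ℕ) := Fin T → TwoCopies n → Bool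

/-- The initial memory of the classical program: `n` and `T` in registers `0` and `1`; the
outcomes of round `t` in row `t`, first those of the first copy (columns `0, …, n - 1`), then those
of the second copy (columns `n, …, 2 * n - 1`); zero elsewhere. -/
def input {n T : ℕ} (ω : Outcomes n T) : Store where
  reg := fun r => if r = 0 then n else if r = 1 then T else 0
  cell := fun r c =>
    if hr : r < T then
      if hc : c < n then (ω ⟨r, hr⟩ (0, ⟨c, hc⟩)).toNat
      else if hc' : c - n < n then (ω ⟨r, hr⟩ (1, ⟨c - n, hc'⟩)).toNat
      else 0
    else 0

/-- The final memory describes the set partition `P`: row `0` holds a label for each qubit, and two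
qubits have the same label if and only if they lie in the same block. -/
def Describes {n : ℕ} (σ : Store) (P : Finpartition (Finset.univ : Finset (Fin n))) : Prop :=
  ∀ i j : Fin n, σ.cell 0 i = σ.cell 0 j ↔ P.part i = P.part j

/-- On the outcomes `ω`, the program halts with the partition `P` as its output. -/
def Outputs {n T : ℕ} (p : Prog) (ω : Outcomes n T)
    (P : Finpartition (Finset.univ : Finset (Fin n))) : Prop :=
  ∃ σ k, Exec p (input ω) σ k ∧ Describes σ P

open Classical in
/-- The probability that the program outputs `P` after `T` rounds of Bell sampling, which are
performed independently of one another on `2 * T` copies of `ψ`. -/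
def successProb {n : ℕ} (p : Prog) (T : ℕ) (ψ : Amp (Fin n))
    (P : Finpartition (Finset.univ : Finset (Fin n))) : ℝ :=
  ∑ ω : Outcomes n T,
    if Outputs p ω P then ∏ t, (bellCircuit n).prob (twoCopies ψ) (ω t) else 0

/-- The running time if the classical program makes `k` steps: in each round one unit of time for
each gate and for the measurement of each qubit. -/
def runtime (n T k : ℕ) : ℕ := T * ((bellCircuit n).size + 2 * n) + k

/-- The number of rounds. -/
def rounds (c : ℝ) (n : ℕ) (ε δ : ℝ) : ℕ := ⌈c * (n + Real.log (1 / δ)) / ε ^ 2⌉₊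

end HiddenCut

end

/-! SWAP is `-1` on the singlet and `1` on the triplets, so the Bell basis diagonalizes every
`swapRep x`, with eigenvalue `(-1)^(y ⬝ x)` on outcomes with singlet pattern `y`; Fourier inversion
over `ℤ₂ⁿ` gives the character POVM. Since `⟨ψψ|SWAP_S|ψψ⟩ = tr ψ_S²`, the pattern `y` of one round
satisfies `y ⬝ x = 0` with probability `(1 + tr ψ_S²)/2`, where `S` is the support of `x`
(`sum_bellProb_filter`).

The purity is multiplicative over the blocks. A factor is `1` where `S` contains or misses the
block. Otherwise `S` cuts the block; some product vector has squared overlap at least the purity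
(`exists_product_overlap`), while trace distance `ε` from all product states forces squared overlaps
to be at most `1 - ε²` (`sq_le_one_sub_overlap`).

Hence indicators of unions of blocks are orthogonal to every observed pattern almost surely, and any
other `x` survives `T` rounds with probability at most `(1 - ε²/2)^T`. A union bound over the `2^n`
vectors shows that the orthogonal complement of the patterns is exactly the space of such
indicators, up to failure probability `2^n (1 - ε²/2)^T ≤ δ` (`one_sub_le_successProb`,
`two_pow_mul_pow_rounds_le`).

The program keeps a matrix over `ℤ₂` whose range is the complement of the patterns processed so far,
with one rank-one update per round (`range_add_vecMulVec`). At the end two qubits share a block iff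
their rows agree, so rows read as binary numbers are labels (`outputs_cutProgram`). -/

namespace HiddenCut

/-! ### The Bell measurement -/

section Bell

variable {n : ℕ}

/-- The matrix of a map on bit strings. -/
def mapMatrix {Q : Type} [Fintype Q] [DecidableEq Q] (f : (Q → Bool) → Q → Bool) :
    Matrix (Q → Bool) (Q → Bool) ℂ :=
  fun s u => if s = f u then 1 else 0

theorem mapMatrix_mul {Q : Type} [Fintype Q] [DecidableEq Q] (f g : (Q → Bool) → Q → Bool) :
    mapMatrix f * mapMatrix g = mapMatrix (f ∘ g) := by
  ext s u
  simp [Matrix.mul_apply, mapMatrix]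

/-- An arbitrary duplicate-free list makes induction possible; without duplicates no target is
flipped twice, and controls are never changed. -/
theorem cnot_list_prod (l : List (Fin n)) (hl : l.Nodup) :
    (l.map fun i => Gate.matrix (.cnot ((0, i) : TwoCopies n) (1, i) (by simp))).prod =
      mapMatrix fun u q => if q.1 = 1 ∧ q.2 ∈ l then xor (u q) (u (0, q.2)) else u q := by
  induction l with
  | nil =>
    ext s u
    simp [mapMatrix, Matrix.one_apply]
  | cons i l ih =>
    rw [List.map_cons, List.prod_cons, ih hl.of_cons]
    have : Gate.matrix (.cnot ((0, i) : TwoCopies n) (1, i) (by simp)) =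
      mapMatrix fun u => Function.update u (1, i) (xor (u (1, i)) (u (0, i))) := rfl
    rw [this, mapMatrix_mul]
    congr 1
    have hi := (List.nodup_cons.1 hl).1
    funext u q
    obtain ⟨c, j⟩ := q
    by_cases hj : j = i
    · subst hj
      by_cases hc : c = 1
      · subst hc; simp [hi]
      · simp [hc]
    · simp [hj]

/-- The matrix entries of the Hadamard gate on one qubit. -/
noncomputable def hadamardEntry (a b : Bool) : ℂ := (if a && b then -1 else 1) / (√2 : ℝ)

/-- The matrix of Hadamard gates on the qubits of the first copy with labels in `l`. -/
noncomputable def hadamardMatrix (l : List (Fin n)) :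
    Matrix (TwoCopies n → Bool) (TwoCopies n → Bool) ℂ :=
  fun s u => if ∀ r : TwoCopies n, ¬ (r.1 = 0 ∧ r.2 ∈ l) → s r = u r then
    (l.map fun i => hadamardEntry (s (0, i)) (u (0, i))).prod else 0

theorem hadamard_list_prod (l : List (Fin n)) (hl : l.Nodup) :
    (l.map fun i => Gate.matrix (.hadamard ((0, i) : TwoCopies n))).prod = hadamardMatrix l := by
  induction l with
  | nil =>
    ext s u
    simp [Matrix.one_apply, funext_iff, hadamardMatrix]
  | cons i l ih =>
    rw [List.map_cons, List.prod_cons, ih hl.of_cons]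
    have hi := (List.nodup_cons.1 hl).1
    ext s u
    -- The only intermediate string: the new gate changes position `(0, i)` alone, and the remaining
    -- gates leave that position fixed because `i ∉ l`.
    rw [Matrix.mul_apply, Finset.sum_eq_single (Function.update s (0, i) (u (0, i)))]
    · have h1 : ∀ j ∈ l, j ≠ i := fun j hj h => hi (h ▸ hj)
      have h2 : (l.map fun j => hadamardEntry (Function.update s (0, i) (u (0, i)) (0, j))
          (u (0, j))) = l.map fun j => hadamardEntry (s (0, j)) (u (0, j)) := by
        refine List.map_congr_left fun j hj => ?_
        rw [Function.update_of_ne]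
        simpa using h1 j hj
      have h3 : (∀ r : TwoCopies n, ¬ (r.1 = 0 ∧ r.2 ∈ l) →
          Function.update s (0, i) (u (0, i)) r = u r) ↔
          ∀ r : TwoCopies n, ¬ (r.1 = 0 ∧ r.2 ∈ i :: l) → s r = u r := by
        constructor
        · intro h r hr
          have hne : r ≠ (0, i) := by
            rintro rfl
            simp at hr
          rw [← h r (fun h' => hr ⟨h'.1, List.mem_cons_of_mem _ h'.2⟩),
            Function.update_of_ne hne]
        · intro h r hr
          by_cases hne : r = (0, i)
          · subst hne; simp
          · rw [Function.update_of_ne hne]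
            refine h r fun h' => hr ⟨h'.1, ?_⟩
            refine (List.mem_cons.1 h'.2).resolve_left fun h'' => hne ?_
            exact Prod.ext h'.1 h''
      simp only [hadamardMatrix, h2, h3, Gate.matrix]
      rw [if_pos]
      · by_cases hc : ∀ r : TwoCopies n, ¬ (r.1 = 0 ∧ r.2 ∈ i :: l) → s r = u r
        · simp only [if_pos hc]
          simp [hadamardEntry]
        · simp only [if_neg hc, mul_zero]
      · intro r hr
        rw [Function.update_of_ne hr]
    · intro w _ hw
      by_contra hne
      have hne' := mul_ne_zero_iff.1 hne
      have ha : ∀ r, r ≠ ((0, i) : TwoCopies n) → s r = w r := by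
        by_contra h
        exact hne'.1 (by simp only [Gate.matrix]; rw [if_neg h])
      have hb : ∀ r : TwoCopies n, ¬ (r.1 = 0 ∧ r.2 ∈ l) → w r = u r := by
        by_contra h
        exact hne'.2 (by simp only [hadamardMatrix]; rw [if_neg h])
      apply hw
      funext r
      by_cases hr : r = (0, i)
      · subst hr
        simpa using hb (0, i) (by simpa using hi)
      · rw [Function.update_of_ne hr, ha r hr]
    · simp

/-- The CNOT layer collapses the sum over intermediate strings; the surviving constraint on the
second copy is the support condition of the Bell states, and the Hadamard entries supply the signs.
Bell amplitudes are real, so no conjugate appears. -/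
theorem bellCircuit_matrix_apply (s u : TwoCopies n → Bool) :
    (bellCircuit n).matrix s u = bellBasis s u := by
  have h1 : (bellCircuit n).matrix =
      ((List.finRange n).map fun i => Gate.matrix (.hadamard ((0, i) : TwoCopies n))).prod *
      ((List.finRange n).map fun i =>
        Gate.matrix (.cnot ((0, i) : TwoCopies n) (1, i) (by simp))).prod := by
    simp only [Circuit.matrix, bellCircuit, Layer.matrix, List.map_cons, List.map_nil,
      List.map_map, List.reverse_cons, List.reverse_nil, List.nil_append, List.cons_append,
      List.prod_cons, List.prod_nil, mul_one]
    rfl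
  rw [h1, cnot_list_prod _ (List.nodup_finRange n), hadamard_list_prod _ (List.nodup_finRange n),
    Matrix.mul_apply]
  simp only [mapMatrix, hadamardMatrix, mul_ite, mul_one, mul_zero, Finset.sum_ite_eq', Finset.mem_univ, if_true,
    List.mem_finRange, and_true]
  simp only [bellBasis, bell]
  by_cases h : ∀ i, u (1, i) = xor (u (0, i)) (s (1, i))
  · rw [if_pos]
    · rw [← List.ofFn_eq_map, List.prod_ofFn]
      refine Finset.prod_congr rfl fun i _ => ?_
      rw [if_pos (h i)]
      simp [hadamardEntry]
    · rintro ⟨c, i⟩ hc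
      have hc' : c = 1 := by
        simp only at hc
        omega
      subst hc'
      simp only [h i, if_true]
      cases s (1, i) <;> cases u (0, i) <;> rfl
  · rw [if_neg]
    · push Not at h
      obtain ⟨i, hi⟩ := h
      rw [Finset.prod_eq_zero (Finset.mem_univ i)]
      rw [if_neg hi]
    · intro h'
      apply h
      intro i
      have := h' (1, i) (by simp)
      simp only [if_true] at this
      rw [this]
      cases u (1, i) <;> cases u (0, i) <;> rfl

theorem star_bell (a b u v : Bool) : star (bell a b u v) = bell a b u v := by
  simp only [bell]
  split_ifs <;> simp

theorem star_bellBasis (s u : TwoCopies n → Bool) : star (bellBasis s u) = bellBasis s u := by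
  simp [bellBasis, star_bell]

theorem bellCircuit_effect (s : TwoCopies n → Bool) :
    (bellCircuit n).effect s = ketbra (bellBasis s) := by
  ext u v
  rw [Circuit.effect, Matrix.mul_assoc, Matrix.mul_apply]
  simp only [Matrix.conjTranspose_apply]
  rw [Finset.sum_eq_single s]
  · rw [Matrix.single_mul_apply_same, bellCircuit_matrix_apply, bellCircuit_matrix_apply,
      star_bellBasis, one_mul, ketbra, Matrix.vecMulVec_apply, Pi.star_apply, star_bellBasis]
  · intro w _ hw
    rw [Matrix.single_mul_apply_of_ne _ _ _ _ _ hw, mul_zero]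
  · simp

theorem bellCircuit_depth : (bellCircuit n).depth = 2 := rfl

theorem bellCircuit_size : (bellCircuit n).size = 2 * n := by
  simp [bellCircuit, Circuit.size]
  ring

/-- The sign character of `ℤ₂`. -/
noncomputable def sgn (z : ZMod 2) : ℂ := (-1) ^ z.val

theorem sgn_zero : sgn 0 = 1 := by simp [sgn]

theorem sgn_one : sgn 1 = -1 := by simp [sgn, ZMod.val_one]

theorem zmod_two_cases (a : ZMod 2) : a = 0 ∨ a = 1 := by
  revert a
  decide

theorem sgn_add (a b : ZMod 2) : sgn (a + b) = sgn a * sgn b := by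
  have h : (1 + 1 : ZMod 2) = 0 := by decide
  rcases zmod_two_cases a with rfl | rfl <;> rcases zmod_two_cases b with rfl | rfl <;>
    simp [sgn_zero, sgn_one, h]

theorem sgn_sum {ι : Type} (s : Finset ι) (f : ι → ZMod 2) :
    sgn (∑ i ∈ s, f i) = ∏ i ∈ s, sgn (f i) := by
  classical
  induction s using Finset.induction_on with
  | empty => simp [sgn_zero]
  | insert a s ha ih => rw [Finset.sum_insert ha, Finset.prod_insert ha, sgn_add, ih]

theorem star_sgn (a : ZMod 2) : star (sgn a) = sgn a := by simp [sgn]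

theorem character_eq_sgn (y x : Fin n → ZMod 2) : character y x = sgn (y ⬝ᵥ x) := rfl

theorem character_eq_prod (y x : Fin n → ZMod 2) : character y x = ∏ i, sgn (y i * x i) := by
  rw [character_eq_sgn, dotProduct, sgn_sum]

/-- Regrouping of the bits of two copies by qubits. -/
def pairEquiv (n : ℕ) : (TwoCopies n → Bool) ≃ (Fin n → Bool × Bool) where
  toFun s i := (s (0, i), s (1, i))
  invFun t q := if q.1 = 0 then (t q.2).1 else (t q.2).2
  left_inv s := by
    funext ⟨c, i⟩
    fin_cases c <;> simp
  right_inv t := by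
    funext i
    simp

/-- The spectral decomposition of SWAP on one pair of qubits (`x = 1`), and completeness of the Bell
basis (`x = 0`). -/
theorem sum_sgn_mul_bell (x : ZMod 2) (u v : Bool × Bool) :
    ∑ t : Bool × Bool, sgn ((if t.1 && t.2 then 1 else 0) * x) *
      (bell t.1 t.2 u.1 u.2 * bell t.1 t.2 v.1 v.2) = (swapGate ^ x.val) u v := by
  have h2 : ((√2 : ℝ) : ℂ) * (√2 : ℝ) = 2 := by
    rw [← Complex.ofReal_mul, Real.mul_self_sqrt (by norm_num)]
    norm_num
  have h0 : ((√2 : ℝ) : ℂ) ≠ 0 := by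
    intro h
    simp [h] at h2
  have h3 : ((√2 : ℝ) : ℂ)⁻¹ * ((√2 : ℝ) : ℂ)⁻¹ = 1 / 2 := by
    rw [← mul_inv, h2, one_div]
  -- The two normalizations combine to `1/2`, which leaves only signs and zeros to check case by
  -- case.
  have key : ∀ t : Bool × Bool, bell t.1 t.2 u.1 u.2 * bell t.1 t.2 v.1 v.2 =
      (if u.2 = xor u.1 t.2 then (if t.1 && u.1 then -1 else 1) else 0) *
      (if v.2 = xor v.1 t.2 then (if t.1 && v.1 then -1 else 1) else 0) * (1 / 2) := by
    intro t
    rw [← h3]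
    simp only [bell, div_eq_mul_inv]
    split_ifs <;> ring
  simp only [key, Fintype.sum_prod_type, Fintype.sum_bool]
  obtain ⟨u1, u2⟩ := u
  obtain ⟨v1, v2⟩ := v
  rcases zmod_two_cases x with rfl | rfl
  · cases u1 <;> cases u2 <;> cases v1 <;> cases v2 <;>
      norm_num [sgn_zero, Matrix.one_apply]
  · cases u1 <;> cases u2 <;> cases v1 <;> cases v2 <;>
      norm_num [sgn_zero, sgn_one, ZMod.val_one, swapGate]

/-- The tensor power of `sum_sgn_mul_bell`: characters and Bell vectors factor over positions, and
the product of sums expands into a sum over all outcomes. -/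
theorem sum_character_effect (x : Fin n → ZMod 2) :
    ∑ s, character (singletPattern s) x • (bellCircuit n).effect s = swapRep x := by
  ext u v
  simp only [Matrix.sum_apply, Matrix.smul_apply, bellCircuit_effect, ketbra,
    Matrix.vecMulVec_apply, Pi.star_apply, star_bellBasis, smul_eq_mul, swapRep]
  simp only [← sum_sgn_mul_bell, Fintype.prod_sum]
  rw [← (pairEquiv n).sum_comp]
  refine Finset.sum_congr rfl fun s _ => ?_
  rw [character_eq_prod, bellBasis, bellBasis, ← Finset.prod_mul_distrib,
    ← Finset.prod_mul_distrib]
  rfl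

theorem sum_sgn_mul (a : ZMod 2) : ∑ b, sgn (a * b) = if a = 0 then 2 else 0 := by
  have h : ∑ b, sgn (a * b) = sgn (a * 0) + sgn (a * 1) := Fin.sum_univ_two _
  rw [h]
  rcases zmod_two_cases a with rfl | rfl <;> norm_num [sgn_zero, sgn_one]

/-- Orthogonality of characters, position by position; in characteristic two `y i + z i` vanishes
iff the entries agree. -/
theorem sum_character_mul (y z : Fin n → ZMod 2) :
    ∑ x, character y x * character z x = if z = y then 2 ^ n else 0 := by
  have h : ∀ x, character y x * character z x = ∏ i, sgn ((y i + z i) * x i) := by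
    intro x
    simp only [character_eq_prod, ← Finset.prod_mul_distrib, add_mul, sgn_add]
  simp only [h]
  rw [← Fintype.prod_sum fun i b => sgn ((y i + z i) * b)]
  simp only [sum_sgn_mul]
  split_ifs with hyz
  · subst hyz
    simp [CharTwo.add_self_eq_zero]
  · obtain ⟨i, hi⟩ := Function.ne_iff.1 hyz
    refine Finset.prod_eq_zero (Finset.mem_univ i) (if_neg fun h0 => hi ?_)
    rw [CharTwo.add_eq_zero] at h0
    exact h0.symm

/-- Fourier inversion of `sum_character_effect`. -/
theorem sum_effect_eq_characterPOVM (y : Fin n → ZMod 2) :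
    ∑ s with singletPattern s = y, (bellCircuit n).effect s = characterPOVM y := by
  simp only [characterPOVM, ← sum_character_effect, Finset.smul_sum, smul_smul]
  rw [Finset.sum_comm]
  simp only [← Finset.sum_smul, ← Finset.mul_sum]
  rw [Finset.sum_filter]
  refine Finset.sum_congr rfl fun s _ => ?_
  have h : ∀ x, star (character y x) * character (singletPattern s) x =
      character y x * character (singletPattern s) x := fun x => by
    rw [character_eq_sgn y, star_sgn]
  simp only [h, sum_character_mul]
  split_ifs <;> simp

end Bell

/-! ### Purities of reduced states -/

section Purity

variable {ι : Type} [Fintype ι] [DecidableEq ι]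

/-- The bit string that is `s` on `S` and `u` off `S`. -/
def mix (S : Finset ι) (s u : ι → Bool) : ι → Bool := fun i => if i ∈ S then s i else u i

omit [Fintype ι] in
theorem mix_def (S : Finset ι) (s u : ι → Bool) :
    mix S s u = fun i => if i ∈ S then s i else u i := rfl

/-- The expectation `⟨ψψ| SWAP_S |ψψ⟩` of the swap of the qubits in `S`. -/
noncomputable def swapExp (ψ : Amp ι) (S : Finset ι) : ℂ :=
  ∑ s, ∑ u, ψ s * ψ u * star (ψ (mix S u s)) * star (ψ (mix S s u))

theorem sum_glue {M : Type} [AddCommMonoid M] (S : Finset ι) (f : (ι → Bool) → M) :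
    ∑ s, f s = ∑ a, ∑ b, f (glue S a b) := by
  rw [← Fintype.sum_prod_type']
  exact Fintype.sum_equiv (Equiv.piEquivPiSubtypeProd (· ∈ S) fun _ => Bool) _ _ fun s => by
    congr 1
    funext i
    by_cases h : i ∈ S <;> simp [glue, h, Equiv.piEquivPiSubtypeProd]

omit [Fintype ι] in
theorem mix_glue (S : Finset ι) (a a' : {i // i ∈ S} → Bool) (b b' : {i // i ∉ S} → Bool) :
    mix S (glue S a b) (glue S a' b') = glue S a b' := by
  funext i
  by_cases h : i ∈ S <;> simp [mix, glue, h]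

theorem reduced_apply (ψ : Amp ι) (S : Finset ι) (a a' : {i // i ∈ S} → Bool) :
    reduced ψ S a a' = ∑ b, ψ (glue S a b) * star (ψ (glue S a' b)) := rfl

theorem swapExp_eq_sum_glue (ψ : Amp ι) (S : Finset ι) :
    swapExp ψ S = ∑ a, ∑ b, ∑ a', ∑ b', ψ (glue S a b) * ψ (glue S a' b') *
      star (ψ (glue S a' b)) * star (ψ (glue S a b')) := by
  rw [swapExp, sum_glue S]
  refine Finset.sum_congr rfl fun a _ => Finset.sum_congr rfl fun b _ => ?_
  rw [sum_glue S]
  simp only [mix_glue]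

/-- The swap trick: both sides are the same fourfold sum over bits inside and outside `S` of the two
copies. -/
theorem trace_reduced_mul_self (ψ : Amp ι) (S : Finset ι) :
    (reduced ψ S * reduced ψ S).trace = swapExp ψ S := by
  simp only [swapExp_eq_sum_glue, Matrix.trace, Matrix.diag_apply, Matrix.mul_apply,
    reduced_apply, Finset.sum_mul_sum]
  refine Finset.sum_congr rfl fun a _ => ?_
  rw [Finset.sum_comm]
  refine Finset.sum_congr rfl fun b _ => Finset.sum_congr rfl fun a' _ =>
    Finset.sum_congr rfl fun b' _ => ?_
  ring

/-- The squared Frobenius norm of the Gram matrix of the slices `ψ (glue S · b)`. This form shows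
nonnegativity and drives the averaging in `exists_product_overlap`. -/
theorem purity_eq_sum (ψ : Amp ι) (S : Finset ι) :
    purity ψ S = ∑ b, ∑ b', ‖∑ a, star (ψ (glue S a b')) * ψ (glue S a b)‖ ^ 2 := by
  have h : swapExp ψ S =
      ((∑ b, ∑ b', ‖∑ a, star (ψ (glue S a b')) * ψ (glue S a b)‖ ^ 2 : ℝ) : ℂ) := by
    push_cast
    simp only [← Complex.mul_conj', map_sum, Finset.sum_mul_sum, map_mul, swapExp_eq_sum_glue]
    rw [Finset.sum_comm]
    refine Finset.sum_congr rfl fun b _ => ?_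
    rw [Finset.sum_congr rfl fun a _ => Finset.sum_comm, Finset.sum_comm]
    refine Finset.sum_congr rfl fun b' _ => Finset.sum_congr rfl fun a _ =>
      Finset.sum_congr rfl fun a' _ => ?_
    simp only [starRingEnd_apply, star_star]
    ring
  rw [purity, trace_reduced_mul_self, h, Complex.ofReal_re]

/-- The reduced state is Hermitian, so the real part in `purity` loses nothing. -/
theorem swapExp_eq_purity (ψ : Amp ι) (S : Finset ι) : swapExp ψ S = purity ψ S := by
  have h : (reduced ψ S)ᴴ = reduced ψ S := by
    ext a a'
    simp only [Matrix.conjTranspose_apply, reduced_apply, star_sum, star_mul, star_star]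
  rw [purity, trace_reduced_mul_self]
  have h2 : star (swapExp ψ S) = swapExp ψ S := by
    rw [← trace_reduced_mul_self, ← Matrix.trace_conjTranspose, Matrix.conjTranspose_mul, h]
  exact (Complex.conj_eq_iff_re.1 h2).symm

theorem purity_nonneg (ψ : Amp ι) (S : Finset ι) : 0 ≤ purity ψ S := by
  rw [purity_eq_sum]
  positivity

theorem sum_mul_star_eq_one {ψ : Amp ι} (hψ : IsStateVector ψ) : ∑ s, ψ s * star (ψ s) = 1 := by
  have h : ∀ s, ψ s * star (ψ s) = ((‖ψ s‖ ^ 2 : ℝ) : ℂ) := fun s => by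
    rw [Complex.ofReal_pow]; exact Complex.mul_conj' _
  simp only [h, ← Complex.ofReal_sum]
  rw [hψ, Complex.ofReal_one]

theorem swapExp_eq_one {ψ : Amp ι} (hψ : IsStateVector ψ) {S : Finset ι}
    (hS : S = ∅ ∨ S = Finset.univ) : swapExp ψ S = 1 := by
  have h : ∀ s u, ψ s * ψ u * star (ψ (mix S u s)) * star (ψ (mix S s u)) =
      (ψ s * star (ψ s)) * (ψ u * star (ψ u)) := by
    intro s u
    rcases hS with rfl | rfl
    · simp only [mix_def, Finset.notMem_empty, if_false]
      ring
    · simp only [mix_def, Finset.mem_univ, if_true]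
      ring
  simp only [swapExp, h, ← Finset.mul_sum, sum_mul_star_eq_one hψ, mul_one]

/-! #### Factorization over blocks -/

/-- Distributivity, since a function on all qubits is the same as a family of functions on the
blocks. It is stated for general `α` so that `α = Bool × Bool` handles both copies at once. -/
theorem sum_prod_parts {α : Type} [Fintype α] (P : Finpartition (Finset.univ : Finset ι))
    (f : (B : Finset ι) → (B → α) → ℂ) :
    ∑ s : ι → α, ∏ B ∈ P.parts, f B (fun i => s i) = ∏ B ∈ P.parts, ∑ t : B → α, f B t := by
  classical
  rw [← Finset.prod_coe_sort, Fintype.prod_sum]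
  let e : (ι → α) → ((B : P.parts) → B.1 → α) := fun s B i => s i.1
  have he : Function.Bijective e := by
    constructor
    · intro s u h
      funext i
      exact congrFun (congrFun h ⟨P.part i, P.part_mem.2 (Finset.mem_univ i)⟩)
        ⟨i, P.mem_part (Finset.mem_univ i)⟩
    · intro x
      refine ⟨fun i => x ⟨P.part i, P.part_mem.2 (Finset.mem_univ i)⟩
        ⟨i, P.mem_part (Finset.mem_univ i)⟩, ?_⟩
      funext ⟨B, hB⟩ ⟨i, hi⟩
      have hpart : P.part i = B := P.part_eq_of_mem hB hi
      subst hpart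
      rfl
  refine Fintype.sum_bijective e he _ _ fun s => ?_
  rw [← Finset.prod_coe_sort]

theorem swapExp_eq_sum_pairs (ψ : Amp ι) (S : Finset ι) :
    swapExp ψ S = ∑ t : ι → Bool × Bool, ψ (fun i => (t i).1) * ψ (fun i => (t i).2) *
      star (ψ (mix S (fun i => (t i).2) fun i => (t i).1)) *
      star (ψ (mix S (fun i => (t i).1) fun i => (t i).2)) := by
  rw [swapExp, ← Fintype.sum_prod_type', ← (Equiv.arrowProdEquivProdArrow ι _ _).sum_comp]
  rfl

theorem swapExp_eq_prod {P : Finpartition (Finset.univ : Finset ι)} {ψ : Amp ι}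
    {φ : (B : Finset ι) → Amp B} (h : IsProductOver P ψ φ) (S : Finset ι) :
    swapExp ψ S = ∏ B ∈ P.parts, swapExp (φ B) (S.subtype (· ∈ B)) := by
  simp only [swapExp_eq_sum_pairs]
  rw [← sum_prod_parts P fun B (t : B → Bool × Bool) => φ B (fun i => (t i).1) * φ B (fun i => (t i).2) *
      star (φ B (mix (S.subtype (· ∈ B)) (fun i => (t i).2) fun i => (t i).1)) *
      star (φ B (mix (S.subtype (· ∈ B)) (fun i => (t i).1) fun i => (t i).2))]
  refine Finset.sum_congr rfl fun t _ => ?_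
  simp only [h _, star_prod, ← Finset.prod_mul_distrib, mix_def,
    Finset.mem_subtype]

theorem purity_eq_prod {P : Finpartition (Finset.univ : Finset ι)} {ψ : Amp ι}
    {φ : (B : Finset ι) → Amp B} (h : IsProductOver P ψ φ) (S : Finset ι) :
    purity ψ S = ∏ B ∈ P.parts, purity (φ B) (S.subtype (· ∈ B)) := by
  have := swapExp_eq_prod h S
  simp only [swapExp_eq_purity] at this
  exact_mod_cast this

theorem purity_eq_one {ψ : Amp ι} (hψ : IsStateVector ψ) {S : Finset ι}
    (hS : S = ∅ ∨ S = Finset.univ) : purity ψ S = 1 := by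
  have := swapExp_eq_one hψ hS
  rw [swapExp_eq_purity] at this
  exact_mod_cast this

/-! #### Overlaps with product states -/

/-- One step of power iteration from a well-chosen slice. For the slices `ψ_b = ψ (glue S · b)`,
with `N b = ‖ψ_b‖²` and `q b = ∑ |⟨ψ_b, ψ_b'⟩|²`, the sums over `b` are `1` and the purity, so some
`b` has `q b / N b` at least the purity. That quotient is the squared overlap with `v = ψ_b / √(N
b)` and `w = ⟨ψ_b, ψ_·⟩ / √(q b)`. -/
theorem exists_product_overlap {ψ : Amp ι} (hψ : IsStateVector ψ) (S : Finset ι) :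
    ∃ (v : Amp {i // i ∈ S}) (w : Amp {i // i ∉ S}), IsStateVector v ∧ IsStateVector w ∧
      purity ψ S ≤ ‖∑ a, ∑ b, star (v a * w b) * ψ (glue S a b)‖ ^ 2 := by
  set q : ({i // i ∉ S} → Bool) → ℝ := fun b =>
    ∑ b', ‖∑ a, star (ψ (glue S a b)) * ψ (glue S a b')‖ ^ 2 with hq
  set N : ({i // i ∉ S} → Bool) → ℝ := fun b => ∑ a, ‖ψ (glue S a b)‖ ^ 2 with hN
  have hN1 : ∑ b, N b = 1 := by
    rw [← hψ, sum_glue S, Finset.sum_comm]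
  have hp : purity ψ S = ∑ b, q b := by
    rw [purity_eq_sum, Finset.sum_comm]
  have hN0 : ∀ b, 0 ≤ N b := fun b => by positivity
  obtain ⟨b, hb0, hb⟩ : ∃ b, N b ≠ 0 ∧ purity ψ S * N b ≤ q b := by
    by_contra! hcon
    have hle : ∀ b, q b ≤ purity ψ S * N b := by
      intro b
      by_cases h : N b = 0
      · have h' : ∀ a, ψ (glue S a b) = 0 := by
          intro a
          have := (Finset.sum_eq_zero_iff_of_nonneg (fun a _ => by positivity)).1 h a
            (Finset.mem_univ a)
          simpa using this
        simp [hq, h, h']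
      · exact (hcon b h).le
    obtain ⟨b, hb⟩ : ∃ b, N b ≠ 0 := by
      by_contra! h
      simp [h] at hN1
    have : ∑ b, q b < ∑ b, purity ψ S * N b :=
      Finset.sum_lt_sum (fun b _ => hle b) ⟨b, Finset.mem_univ b, hcon b hb⟩
    rw [← Finset.mul_sum, hN1, mul_one, ← hp] at this
    exact lt_irrefl _ this
  have hNb : 0 < N b := lt_of_le_of_ne (hN0 b) hb0.symm
  set r := √(N b) with hr
  have hr0 : 0 < r := Real.sqrt_pos.2 hNb
  have hr2 : r ^ 2 = N b := Real.sq_sqrt hNb.le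
  set g : Amp {i // i ∉ S} := fun b' => ∑ a, star (ψ (glue S a b)) * ψ (glue S a b') with hg
  have hqg : q b = ∑ b', ‖g b'‖ ^ 2 := rfl
  have hgb : g b = (N b : ℂ) := by
    simp only [hg, hN, Complex.ofReal_sum, Complex.ofReal_pow]
    exact Finset.sum_congr rfl fun a _ => Complex.conj_mul' _
  -- Needed to normalize `w`: the diagonal term of `q b` is `(N b)²`, which is positive.
  have hq0 : 0 < q b := by
    have h1 : ‖g b‖ ^ 2 ≤ q b := by
      rw [hqg]
      exact Finset.single_le_sum (f := fun b' => ‖g b'‖ ^ 2) (fun _ _ => by positivity)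
        (Finset.mem_univ b)
    refine lt_of_lt_of_le ?_ h1
    rw [hgb, Complex.norm_real]
    have := norm_pos_iff.2 hb0
    positivity
  set t := √(q b) with ht
  have ht0 : 0 < t := Real.sqrt_pos.2 hq0
  have ht2 : t ^ 2 = q b := Real.sq_sqrt hq0.le
  refine ⟨fun a => ψ (glue S a b) / r, fun b' => g b' / t, ?_, ?_, ?_⟩
  · simp only [IsStateVector, norm_div, Complex.norm_real, div_pow, Real.norm_eq_abs, sq_abs,
      ← Finset.sum_div]
    rw [hr2]
    exact div_self hb0
  · simp only [IsStateVector, norm_div, Complex.norm_real, div_pow, Real.norm_eq_abs, sq_abs,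
      ← Finset.sum_div]
    rw [ht2, ← hqg]
    exact div_self hq0.ne'
  · have h1 : ∑ a, ∑ b', star (ψ (glue S a b) / r * (g b' / t)) * ψ (glue S a b') =
        ((t / r : ℝ) : ℂ) := by
      have h2 : ∀ b', ∑ a, star (ψ (glue S a b) / r * (g b' / t)) * ψ (glue S a b') =
          ((‖g b'‖ ^ 2 : ℝ) : ℂ) / (r * t) := by
        intro b'
        have h3 : ((‖g b'‖ ^ 2 : ℝ) : ℂ) = star (g b') * g b' := by
          rw [Complex.ofReal_pow]; exact (Complex.conj_mul' _).symm
        rw [h3]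
        conv_rhs => rw [hg]
        simp only [Finset.mul_sum, Finset.sum_div]
        refine Finset.sum_congr rfl fun a _ => ?_
        simp only [star_mul', star_div₀, hg]
        have h4 : star (r : ℂ) = r := Complex.conj_ofReal r
        have h5 : star (t : ℂ) = t := Complex.conj_ofReal t
        rw [h4, h5]
        simp only [div_eq_mul_inv, mul_inv]
        ring
      rw [Finset.sum_comm]
      simp only [h2, ← Finset.sum_div, ← Complex.ofReal_sum]
      rw [← hqg, ← ht2]
      have hrc : (r : ℂ) ≠ 0 := by exact_mod_cast hr0.ne'
      have htc : (t : ℂ) ≠ 0 := by exact_mod_cast ht0.ne'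
      push_cast
      field_simp
    rw [h1, Complex.norm_real, Real.norm_eq_abs, sq_abs, div_pow, hr2, ht2, le_div_iff₀ hNb]
    exact hb

theorem isMultipartiteProduct_mul {S : Finset ι} (h0 : S ≠ ∅) (h1 : S ≠ Finset.univ)
    {v : Amp {i // i ∈ S}} {w : Amp {i // i ∉ S}} (hv : IsStateVector v) (hw : IsStateVector w) :
    IsMultipartiteProduct fun s : ι → Bool => v (fun i => s i) * w (fun i => s i) := by
  have hc : Sᶜ ≠ (∅ : Finset ι) := by simpa using h1
  have hne : Sᶜ ≠ S := by
    obtain ⟨i, hi⟩ := Finset.nonempty_iff_ne_empty.2 h0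
    intro h
    have := h ▸ hi
    simp [hi] at this
  -- The factors must be given on every finset `A`; the default bit `false` is never reached when
  -- `A` is one of the two blocks `S` and `Sᶜ`.
  refine ⟨(Finpartition.indiscrete (a := S) h0).extend (b := Sᶜ) hc disjoint_compl_right
    (by simp), fun A s => if A = S then
      v (fun i => if h : i.1 ∈ A then s ⟨i, h⟩ else false) else
      w (fun i => if h : i.1 ∈ A then s ⟨i, h⟩ else false), ?_, ?_, ?_⟩
  · simp [Finset.card_pair hne]
  · intro B hB
    simp only [Finpartition.extend_parts, Finpartition.indiscrete_parts, Finset.mem_insert,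
      Finset.mem_singleton] at hB
    rcases hB with rfl | rfl
    · simp only [if_neg hne, IsStateVector]
      rw [← hw]
      refine Fintype.sum_equiv (Equiv.arrowCongr
        (Equiv.subtypeEquivRight fun i => Finset.mem_compl) (Equiv.refl Bool)) _ _ fun s => ?_
      congr 3
      funext ⟨i, hi⟩
      simp only [hi, not_false_eq_true, Finset.mem_compl, dif_pos]
      rfl
    · simpa [IsStateVector] using hv
  · intro s
    simp [Finset.prod_pair hne, hne]
    rw [mul_comm]
    congr 1
    congr 1
    funext ⟨i, hi⟩
    simp [hi]

/-! #### Trace distance and overlap -/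

-- Cauchy–Schwarz over the nonzero singular values, whose number is the rank.
open scoped ComplexOrder in
theorem traceNorm_le_sqrt {I : Type} [Fintype I] [DecidableEq I] (M : Matrix I I ℂ) :
    traceNorm M ≤ √(M.rank * (Mᴴ * M).trace.re) := by
  have hH := Matrix.isHermitian_conjTranspose_mul_self M
  have hpos : ∀ i, 0 ≤ hH.eigenvalues i :=
    (Matrix.posSemidef_conjTranspose_mul_self M).eigenvalues_nonneg
  have htr : (Mᴴ * M).trace.re = ∑ i, hH.eigenvalues i := by
    rw [hH.trace_eq_sum_eigenvalues]
    simp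
  have hrank : M.rank = (Finset.univ.filter fun i => hH.eigenvalues i ≠ 0).card := by
    rw [← Matrix.rank_conjTranspose_mul_self, hH.rank_eq_card_non_zero_eigs, Fintype.card_subtype]
  apply Real.le_sqrt_of_sq_le
  rw [htr, hrank, traceNorm, ← Finset.sum_filter_of_ne (p := fun i => hH.eigenvalues i ≠ 0)
    (fun i _ h h0 => h (by rw [h0, Real.sqrt_zero]))]
  refine sq_sum_le_card_mul_sum_sq.trans (mul_le_mul_of_nonneg_left ?_ (Nat.cast_nonneg _))
  refine (Finset.sum_le_univ_sum_of_nonneg fun i => sq_nonneg _).trans (le_of_eq ?_)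
  exact Finset.sum_congr rfl fun i _ => Real.sq_sqrt (hpos i)

theorem matrix_rank_add_le {I : Type} [Fintype I] (M N : Matrix I I ℂ) :
    (M + N).rank ≤ M.rank + N.rank := by
  rw [Matrix.rank, Matrix.mulVecLin_add]
  refine (Submodule.finrank_mono (LinearMap.range_add_le _ _)).trans ?_
  exact Submodule.finrank_add_le_finrank_add_finrank _ _

theorem rank_ketbra_sub_le (φ χ : Amp ι) : (ketbra φ - ketbra χ).rank ≤ 2 := by
  have h : ketbra φ - ketbra χ = ketbra φ + Matrix.vecMulVec (-χ) (star χ) := by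
    rw [Matrix.neg_vecMulVec, ← sub_eq_add_neg]
    rfl
  rw [h]
  exact (matrix_rank_add_le _ _).trans
    (add_le_add (Matrix.rank_vecMulVec_le _ _) (Matrix.rank_vecMulVec_le _ _))

theorem trace_ketbra_sub {φ χ : Amp ι} (hφ : IsStateVector φ) (hχ : IsStateVector χ) :
    ((ketbra φ - ketbra χ)ᴴ * (ketbra φ - ketbra χ)).trace.re =
      2 * (1 - ‖∑ s, star (χ s) * φ s‖ ^ 2) := by
  have h1 : ∀ ψ : Amp ι, (ketbra ψ)ᴴ = ketbra ψ := fun ψ => by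
    rw [ketbra, Matrix.conjTranspose_vecMulVec, star_star]
  have h2 : ∀ ψ ψ' : Amp ι, (ketbra ψ * ketbra ψ').trace = (star ψ ⬝ᵥ ψ') * (star ψ' ⬝ᵥ ψ) := by
    intro ψ ψ'
    rw [ketbra, ketbra, Matrix.vecMulVec_mul_vecMulVec, Matrix.trace_vecMulVec, dotProduct_smul]
    simp [dotProduct_comm]
  have h3 : ∀ ψ : Amp ι, IsStateVector ψ → star ψ ⬝ᵥ ψ = 1 := by
    intro ψ hψ
    rw [dotProduct_comm]
    exact sum_mul_star_eq_one hψ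
  have h4 : (star χ ⬝ᵥ φ) * (star φ ⬝ᵥ χ) = ((‖∑ s, star (χ s) * φ s‖ ^ 2 : ℝ) : ℂ) := by
    rw [Complex.ofReal_pow, ← Complex.mul_conj']
    congr 1
    rw [map_sum]
    exact Finset.sum_congr rfl fun s _ => by simp [mul_comm]
  rw [Matrix.conjTranspose_sub, h1, h1, Matrix.sub_mul, Matrix.mul_sub, Matrix.mul_sub]
  simp only [Matrix.trace_sub, h2, h3 φ hφ, h3 χ hχ, h4]
  rw [mul_comm (star φ ⬝ᵥ χ), h4]
  simp only [Complex.sub_re, Complex.ofReal_re, mul_one, Complex.one_re]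
  ring

/-- A difference of two pure states has rank at most two and squared Hilbert–Schmidt norm `2 (1 -
F)`, with `F` the squared overlap, so its trace norm is at most `2 √(1 - F)`. -/
theorem sq_le_one_sub_overlap {ε : ℝ} (hε : 0 < ε) {φ χ : Amp ι} (hφ : IsStateVector φ)
    (hχ : IsStateVector χ) (h : ε ≤ traceDist φ χ) :
    ε ^ 2 ≤ 1 - ‖∑ s, star (χ s) * φ s‖ ^ 2 := by
  have h1 := traceNorm_le_sqrt (ketbra φ - ketbra χ)
  have h2 : 2 * ε ≤ √((ketbra φ - ketbra χ).rank *
      ((ketbra φ - ketbra χ)ᴴ * (ketbra φ - ketbra χ)).trace.re) := by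
    rw [traceDist] at h
    linarith
  have h3 := Real.le_sqrt' (by positivity) |>.1 h2
  rw [trace_ketbra_sub hφ hχ] at h3
  have h4 : ((ketbra φ - ketbra χ).rank : ℝ) ≤ 2 := by exact_mod_cast rank_ketbra_sub_le φ χ
  have h5 : 0 ≤ ((ketbra φ - ketbra χ).rank : ℝ) := Nat.cast_nonneg _
  -- A nonpositive `1 - F` would give `4 ε² ≤ 0`; this avoids a separate proof that the overlap is
  -- at most one.
  rcases le_total 0 (1 - ‖∑ s, star (χ s) * φ s‖ ^ 2) with hx | hx
  · have := mul_le_mul_of_nonneg_right h4 (mul_nonneg zero_le_two hx)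
    linarith
  · have := mul_nonneg h5 (neg_nonneg.2 hx)
    nlinarith

theorem purity_le_of_far {ε : ℝ} (hε : 0 < ε) {φ : Amp ι} (hφ : IsStateVector φ)
    (hfar : ∀ χ : Amp ι, IsMultipartiteProduct χ → ε ≤ traceDist φ χ) {S : Finset ι}
    (h0 : S ≠ ∅) (h1 : S ≠ Finset.univ) : purity φ S ≤ 1 - ε ^ 2 := by
  obtain ⟨v, w, hv, hw, hle⟩ := exists_product_overlap hφ S
  have hglue : ∀ a b, (fun s : ι → Bool => v (fun i => s i) * w (fun i => s i)) (glue S a b) =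
      v a * w b := by
    intro a b
    have ha : (fun i : {i // i ∈ S} => glue S a b i) = a := by
      funext ⟨i, hi⟩
      simp [glue, hi]
    have hb : (fun i : {i // i ∉ S} => glue S a b i) = b := by
      funext ⟨i, hi⟩
      simp [glue, hi]
    simp only [ha, hb]
  have hχ : IsStateVector fun s : ι → Bool => v (fun i => s i) * w (fun i => s i) := by
    rw [IsStateVector, sum_glue S]
    simp only [hglue, norm_mul, mul_pow, ← Finset.mul_sum]
    rw [hw]
    simp only [mul_one]
    exact hv
  have h2 := sq_le_one_sub_overlap hε hφ hχ (hfar _ (isMultipartiteProduct_mul h0 h1 hv hw))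
  rw [sum_glue S] at h2
  simp only [hglue] at h2
  linarith

end Purity

/-! ### The purity gap for the hidden partition. -/

section PurityGap

variable {n : ℕ} {ε : ℝ} {ψ : Amp (Fin n)} {P : Finpartition (Finset.univ : Finset (Fin n))}

/-- Rephrases being a union of blocks block by block, to match the factorization `purity_eq_prod`.
-/
theorem eq_biUnion_iff (S : Finset (Fin n)) :
    (∃ F ⊆ P.parts, S = F.biUnion id) ↔
      ∀ B ∈ P.parts, S.subtype (· ∈ B) = ∅ ∨ S.subtype (· ∈ B) = Finset.univ := by
  constructor
  · rintro ⟨F, hF, rfl⟩ B hB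
    by_cases hBF : B ∈ F
    · right
      ext ⟨i, hi⟩
      simpa using ⟨B, hBF, hi⟩
    · left
      ext ⟨i, hi⟩
      simp only [Finset.mem_subtype, Finset.mem_biUnion, id, Finset.notMem_empty, iff_false]
      rintro ⟨A, hA, hiA⟩
      exact hBF (P.eq_of_mem_parts hB (hF hA) hi hiA ▸ hA)
  · intro h
    refine ⟨P.parts.filter (· ⊆ S), Finset.filter_subset _ _, ?_⟩
    ext i
    simp only [Finset.mem_biUnion, Finset.mem_filter, id]
    constructor
    · intro hi
      have hB := P.part_mem.2 (Finset.mem_univ i)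
      have hiB := P.mem_part (Finset.mem_univ i)
      refine ⟨P.part i, ⟨hB, ?_⟩, hiB⟩
      rcases h _ hB with h' | h'
      · have : (⟨i, hiB⟩ : P.part i) ∈ S.subtype (· ∈ P.part i) := by simpa using hi
        rw [h'] at this
        simp at this
      · intro j hj
        have : (⟨j, hj⟩ : P.part i) ∈ S.subtype (· ∈ P.part i) := by
          rw [h']
          exact Finset.mem_univ _
        simpa using this
    · rintro ⟨B, ⟨_, hBS⟩, hi⟩
      exact hBS hi

theorem purity_eq_one_of_union (h : IsHiddenManyCut ε ψ P) {S : Finset (Fin n)}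
    (hS : ∃ F ⊆ P.parts, S = F.biUnion id) : purity ψ S = 1 := by
  obtain ⟨_, φ, hφ, hB⟩ := h
  rw [purity_eq_prod hφ]
  exact Finset.prod_eq_one fun B hBP =>
    purity_eq_one (hB B hBP).1 ((eq_biUnion_iff S).1 hS B hBP)

theorem purity_le_of_not_union (hε : 0 < ε) (h : IsHiddenManyCut ε ψ P) {S : Finset (Fin n)}
    (hS : ¬ ∃ F ⊆ P.parts, S = F.biUnion id) : purity ψ S ≤ 1 - ε ^ 2 := by
  obtain ⟨_, φ, hφ, hB⟩ := h
  rw [eq_biUnion_iff] at hS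
  push Not at hS
  obtain ⟨B, hBP, h0, h1⟩ := hS
  -- One cut block already gives a factor at most `1 - ε²`; all other factors lie between `0` and
  -- `1`.
  rw [purity_eq_prod hφ, ← Finset.mul_prod_erase _ _ hBP]
  have hle : ∏ A ∈ P.parts.erase B, purity (φ A) (S.subtype (· ∈ A)) ≤ 1 := by
    refine Finset.prod_le_one (fun A _ => purity_nonneg _ _) fun A hA => ?_
    have hA' := hB A (Finset.mem_of_mem_erase hA)
    by_cases hc : S.subtype (· ∈ A) = ∅ ∨ S.subtype (· ∈ A) = Finset.univ
    · exact (purity_eq_one hA'.1 hc).le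
    · push Not at hc
      have := purity_le_of_far hε hA'.1 hA'.2 (Finset.nonempty_iff_ne_empty.1 hc.1) hc.2
      nlinarith
  have := purity_le_of_far hε (hB B hBP).1 (hB B hBP).2 (Finset.nonempty_iff_ne_empty.1 h0) h1
  nlinarith [purity_nonneg (φ B) (S.subtype (· ∈ B))]

end PurityGap

/-! ### Reasoning about programs -/

section Programs

/-- The effect of a program without loops. -/
def Prog.den : Prog → Store → Store
  | .const d v, σ => σ.setReg d v
  | .add d a b, σ => σ.setReg d (σ.reg a + σ.reg b)
  | .sub d a b, σ => σ.setReg d (σ.reg a - σ.reg b)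
  | .load d r c, σ => σ.setReg d (σ.cell (σ.reg r) (σ.reg c))
  | .store r c a, σ => σ.setCell (σ.reg r) (σ.reg c) (σ.reg a)
  | .seq p q, σ => q.den (p.den σ)
  | .ite a p q, σ => if σ.reg a ≠ 0 then p.den σ else q.den σ
  | .loop _ _, σ => σ

/-- A bound on the running time of a program without loops. -/
def Prog.cost : Prog → ℕ
  | .seq p q => p.cost + q.cost
  | .ite _ p q => max p.cost q.cost + 1
  | _ => 1

def Prog.LoopFree : Prog → Prop
  | .seq p q => p.LoopFree ∧ q.LoopFree
  | .ite _ p q => p.LoopFree ∧ q.LoopFree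
  | .loop _ _ => False
  | _ => True

theorem exec_den (p : Prog) (hp : p.LoopFree) (σ : Store) :
    ∃ k, Exec p σ (p.den σ) k ∧ k ≤ p.cost := by
  induction p generalizing σ with
  | const | add | sub | load | store => exact ⟨1, by constructor, le_rfl⟩
  | seq p q ihp ihq =>
    obtain ⟨k, hk, hk'⟩ := ihp hp.1 σ
    obtain ⟨l, hl, hl'⟩ := ihq hp.2 (p.den σ)
    exact ⟨k + l, .seq hk hl, Nat.add_le_add hk' hl'⟩
  | ite a p q ihp ihq =>
    by_cases h : σ.reg a = 0
    · obtain ⟨l, hl, hl'⟩ := ihq hp.2 σ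
      refine ⟨l + 1, ?_, Nat.succ_le_succ (hl'.trans (le_max_right _ _))⟩
      simp only [Prog.den, h, ne_eq, not_true_eq_false, if_false]
      exact .iteFalse h hl
    · obtain ⟨l, hl, hl'⟩ := ihp hp.1 σ
      refine ⟨l + 1, ?_, Nat.succ_le_succ (hl'.trans (le_max_left _ _))⟩
      simp only [Prog.den, h, ne_eq, not_false_eq_true, if_true]
      exact .iteTrue h hl
  | loop => exact hp.elim

/-- Started in `σ`, the program halts within `K` steps in a store that satisfies `Q`. -/
def HaltsWith (p : Prog) (σ : Store) (K : ℕ) (Q : Store → Prop) : Prop :=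
  ∃ σ' k, Exec p σ σ' k ∧ k ≤ K ∧ Q σ'

theorem HaltsWith.of_den {p : Prog} {σ : Store} {Q : Store → Prop} (hp : p.LoopFree)
    (h : Q (p.den σ)) : HaltsWith p σ p.cost Q :=
  let ⟨k, hk, hk'⟩ := exec_den p hp σ
  ⟨_, k, hk, hk', h⟩

theorem HaltsWith.seq {p q : Prog} {σ : Store} {K L : ℕ} {Q R : Store → Prop}
    (hp : HaltsWith p σ K Q) (hq : ∀ τ, Q τ → HaltsWith q τ L R) :
    HaltsWith (.seq p q) σ (K + L) R := by
  obtain ⟨τ, k, hk, hkK, hτ⟩ := hp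
  obtain ⟨ρ, l, hl, hlL, hρ⟩ := hq τ hτ
  exact ⟨ρ, k + l, .seq hk hl, Nat.add_le_add hkK hlL, hρ⟩

theorem HaltsWith.mono {p : Prog} {σ : Store} {K L : ℕ} {Q R : Store → Prop}
    (hp : HaltsWith p σ K Q) (hKL : K ≤ L) (hQR : ∀ τ, Q τ → R τ) : HaltsWith p σ L R := by
  obtain ⟨τ, k, hk, hkK, hτ⟩ := hp
  exact ⟨τ, k, hk, hkK.trans hKL, hQR τ hτ⟩

/-- Execution of `p` with register `i` counting down from the value of register `b`, exclusive,
to zero. Registers `2` and `3` have to contain `1` and `0`. -/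
def forDown (i b : ℕ) (p : Prog) : Prog :=
  .seq (.add i b 3) (.loop i (.seq (.sub i i 2) p))

/-- `I m` is the invariant at the loop test with counter `m`; the body starts after the decrement
and leads from `I (m + 1)` to `I m`. Each pass costs a test and a subtraction besides the body; the
initial copy and the last test give the final `+ 2`. -/
theorem HaltsWith.forDown {i b : ℕ} {p : Prog} {σ : Store} {N K : ℕ} (I : ℕ → Store → Prop)
    (hb : σ.reg b = N) (h3 : σ.reg 3 = 0) (h0 : I N (σ.setReg i N))
    (hI : ∀ m τ, I m τ → τ.reg i = m ∧ τ.reg 2 = 1)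
    (hp : ∀ m < N, ∀ τ, I (m + 1) τ → HaltsWith p (τ.setReg i m) K (I m)) :
    HaltsWith (forDown i b p) σ (N * (K + 2) + 2) (I 0) := by
  have key : ∀ m ≤ N, ∀ τ, I m τ →
      HaltsWith (.loop i (.seq (.sub i i 2) p)) τ (m * (K + 2) + 1) (I 0) := by
    intro m
    induction m with
    | zero =>
      intro _ τ hτ
      exact ⟨τ, 1, .loopStop (hI 0 τ hτ).1, by omega, hτ⟩
    | succ m ih =>
      intro hm τ hτ
      obtain ⟨hi, h2⟩ := hI _ τ hτ
      obtain ⟨ρ, k, hk, hkK, hρ⟩ := hp m hm τ hτ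
      obtain ⟨ρ', l, hl, hlK, hρ'⟩ := ih (by omega) ρ hρ
      have hsub : Exec (.sub i i 2) τ (τ.setReg i m) 1 := by
        have := Exec.sub τ i i 2
        rwa [hi, h2, Nat.add_sub_cancel] at this
      refine ⟨ρ', 1 + k + l + 1, .loopStep (by omega) (.seq hsub hk) hl, ?_, hρ'⟩
      rw [Nat.succ_mul]
      omega
  obtain ⟨ρ, k, hk, hkK, hρ⟩ := key N le_rfl _ h0
  have hadd : Exec (.add i b 3) σ (σ.setReg i N) 1 := by
    have := Exec.add σ i b 3
    rwa [hb, h3, Nat.add_zero] at this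
  exact ⟨ρ, 1 + k, .seq hadd hk, by omega, hρ⟩

end Programs

/-! ### The classical program -/

section Program

open Prog

/-- Sequential execution of a list of programs. -/
def block (p : Prog) : List Prog → Prog
  | [] => p
  | q :: l => .seq p (block q l)

/-- Add, modulo two, to the row with number in register `d` the row with number in register `s`,
unless register `9` is one. -/
def rowAddBody (s d : ℕ) : Prog :=
  block (load 12 s 11) [sub 12 12 9, load 13 d 11, sub 14 13 12, sub 15 12 13, add 14 14 15,
    store d 11 14]

def rowAdd (s d : ℕ) : Prog := forDown 11 0 (rowAddBody s d)

def clearRow : Prog := forDown 11 0 (store 5 11 3)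

def initMatrix : Prog := forDown 7 0 (.seq (add 8 4 7) (store 8 7 2))

/-- One minus the singlet indicator of qubit `i` in round `t`. -/
def loadSinglet : Prog :=
  block (add 8 4 7) [add 12 0 7, load 13 6 7, load 14 6 12, sub 14 2 14, sub 13 13 14, sub 9 2 13]

def applyVector : Prog := forDown 7 0 (.seq loadSinglet (rowAdd 8 5))

/-- Counting down leaves the smallest index of a nonzero entry in register `10`. The default `0` is
harmless: it remains only if the row is zero, and then elimination adds nothing. -/
def findPivot : Prog :=
  .seq (const 10 0) (forDown 11 0 (.seq (load 12 5 11) (ite 12 (add 10 11 3) (const 13 0))))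

def loadPivot : Prog := block (add 8 4 7) [load 9 8 10, sub 9 2 9]

def eliminate : Prog := forDown 7 0 (.seq loadPivot (rowAdd 5 8))

def processRound : Prog := block clearRow [applyVector, findPivot, eliminate]

def labelRow : Prog :=
  .seq (.seq (add 8 4 7) (const 9 0))
    (.seq (forDown 11 0 (block (add 9 9 9) [load 12 8 11, add 9 9 12])) (store 3 7 9))

/-- The matrix starts at row `T + 1` rather than `T`, so that row `0`, which receives the labels, is
not a matrix row even for `T = 0`. Register `5` points to a scratch row just behind the matrix. -/
def initConstants : Prog := block (const 2 1) [const 3 0, add 4 1 2, add 5 4 0]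

/-- For each round, eliminate from the rows of a matrix over `ℤ₂`, initially the identity, the
combination of rows that is given by the singlet pattern; finally output the rows as binary
numbers. -/
def cutProgram : Prog :=
  block initConstants [initMatrix, forDown 6 1 processRound, forDown 7 0 labelRow]

/-- Arithmetic modulo two by truncated subtraction: for bits, `u - (1 - x)` is the product and `(v -
w) + (w - v)` the exclusive or. -/
theorem val_add_mul (v u x : ZMod 2) :
    (v + u * x).val = v.val - (u.val - (1 - x.val)) + (u.val - (1 - x.val) - v.val) := by
  revert v u x
  decide

/-- Registers `0` to `5` contain their fixed values. -/
structure Consts (n T : ℕ) (σ : Store) : Prop where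
  r0 : σ.reg 0 = n
  r1 : σ.reg 1 = T
  r2 : σ.reg 2 = 1
  r3 : σ.reg 3 = 0
  r4 : σ.reg 4 = T + 1
  r5 : σ.reg 5 = T + 1 + n

theorem Consts.congr {n T : ℕ} {σ τ : Store} (h : Consts n T σ) {k : ℕ} (hk : 6 ≤ k)
    (hr : ∀ r < k, τ.reg r = σ.reg r) : Consts n T τ where
  r0 := by rw [hr 0 (by omega), h.r0]
  r1 := by rw [hr 1 (by omega), h.r1]
  r2 := by rw [hr 2 (by omega), h.r2]
  r3 := by rw [hr 3 (by omega), h.r3]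
  r4 := by rw [hr 4 (by omega), h.r4]
  r5 := by rw [hr 5 (by omega), h.r5]

variable {n T : ℕ}

/-- With `p = y ᵥ* ℓ`, the new matrix maps `a` to `ℓ (a + (p ⬝ a) e_j)`. Pairing with `y` gives `(p
⬝ a) (1 + p j)`, which is zero if `p j = 1` or `p = 0`. Conversely, if `y ⬝ ℓ a = 0`, the correction
vanishes and `ℓ a` is still attained. -/
theorem range_add_vecMulVec (ℓ : Matrix (Fin n) (Fin n) (ZMod 2)) (y : Fin n → ZMod 2)
    (j : Fin n) (hj : y ᵥ* ℓ = 0 ∨ (y ᵥ* ℓ) j = 1) (x : Fin n → ZMod 2) :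
    (∃ a, (ℓ + Matrix.vecMulVec (fun i => ℓ i j) (y ᵥ* ℓ)) *ᵥ a = x) ↔
      (∃ a, ℓ *ᵥ a = x) ∧ y ⬝ᵥ x = 0 := by
  have hcol : (fun i => ℓ i j) = ℓ *ᵥ Pi.single j 1 := by
    ext i
    simp
  have hmul : ∀ a, (ℓ + Matrix.vecMulVec (fun i => ℓ i j) (y ᵥ* ℓ)) *ᵥ a =
      ℓ *ᵥ (a + (y ⬝ᵥ ℓ *ᵥ a) • Pi.single j 1) := by
    intro a
    rw [Matrix.add_mulVec, Matrix.vecMulVec_mulVec, Matrix.dotProduct_mulVec, Matrix.mulVec_add,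
      Matrix.mulVec_smul, hcol]
    simp
  constructor
  · rintro ⟨a, rfl⟩
    rw [hmul]
    refine ⟨⟨_, rfl⟩, ?_⟩
    rw [Matrix.dotProduct_mulVec, dotProduct_add, dotProduct_smul, Matrix.dotProduct_mulVec,
      dotProduct_single_one]
    rcases hj with h | h
    · simp [h]
    · simp [h, CharTwo.add_self_eq_zero]
  · rintro ⟨⟨a, rfl⟩, h⟩
    exact ⟨a, by rw [hmul, h, zero_smul, add_zero]⟩

/-! ### Correctness and running time of the subroutines and of the whole program. -/

theorem haltsWith_rowAdd {σ : Store} (hσ : Consts n T σ) {s d : ℕ} (hs : s < 11) (hd : d < 11)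
    (hsd : σ.reg s ≠ σ.reg d) {u v : Fin n → ZMod 2} {x : ZMod 2} (h9 : σ.reg 9 = 1 - x.val)
    (hu : ∀ j : Fin n, σ.cell (σ.reg s) j = (u j).val)
    (hv : ∀ j : Fin n, σ.cell (σ.reg d) j = (v j).val) :
    HaltsWith (rowAdd s d) σ (n * 9 + 2) fun τ => (∀ r < 11, τ.reg r = σ.reg r) ∧
      (∀ j : Fin n, τ.cell (σ.reg d) j = (v j + u j * x).val) ∧
      ∀ r ≠ σ.reg d, ∀ c, τ.cell r c = σ.cell r c := by
  refine (HaltsWith.forDown (K := 7) (fun m τ => τ.reg 11 = m ∧ (∀ r < 11, τ.reg r = σ.reg r) ∧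
      (∀ j : Fin n, τ.cell (σ.reg d) j = if m ≤ j then (v j + u j * x).val else (v j).val) ∧
      ∀ r ≠ σ.reg d, ∀ c, τ.cell r c = σ.cell r c) hσ.r0 hσ.r3 ?_ ?_ ?_).mono le_rfl ?_
  · refine ⟨by simp [Store.setReg], fun r hr => ?_, fun j => ?_, fun r _ c => rfl⟩
    · simp [Store.setReg, hr.ne]
    · rw [if_neg (by omega)]
      exact hv j
  · intro m τ h
    exact ⟨h.1, by rw [h.2.1 2 (by omega), hσ.r2]⟩
  · rintro m hm τ ⟨_, hr, hcd, hc⟩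
    refine HaltsWith.of_den (p := rowAddBody s d) (by simp [rowAddBody, block, LoopFree]) ?_
    have hs' := hr s hs
    have hd' := hr d hd
    have h9' := hr 9 (by omega)
    have e1 : s ≠ 11 := by omega
    have e2 : d ≠ 11 := by omega
    have e3 : d ≠ 12 := by omega
    have e4 : d ≠ 13 := by omega
    have e5 : d ≠ 14 := by omega
    have e6 : d ≠ 15 := by omega
    have f1 : τ.cell (σ.reg s) m = (u ⟨m, hm⟩).val := by rw [hc _ hsd, ← hu ⟨m, hm⟩]
    have f2 : τ.cell (σ.reg d) m = (v ⟨m, hm⟩).val := by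
      have := hcd ⟨m, hm⟩
      rwa [if_neg (by simp)] at this
    refine ⟨?_, fun r hr' => ?_, fun j => ?_, fun r hr' c => ?_⟩
    · simp [rowAddBody, block, den, Store.setReg, Store.setCell]
    · have g1 : r ≠ 11 := by omega
      have g2 : r ≠ 12 := by omega
      have g3 : r ≠ 13 := by omega
      have g4 : r ≠ 14 := by omega
      have g5 : r ≠ 15 := by omega
      simp [rowAddBody, block, den, Store.setReg, Store.setCell, g1, g2, g3, g4, g5, hr r hr']
    · simp only [rowAddBody, block, den, Store.setReg, Store.setCell]
      simp [e1, e2, e3, e4, e5, e6, hs', hd', h9', h9, f1, f2]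
      by_cases hj : (j : ℕ) = m
      · obtain rfl : j = ⟨m, hm⟩ := Fin.ext hj
        simp [val_add_mul]
      · rw [Function.update_of_ne hj, hcd j]
        have : m + 1 ≤ j ↔ m ≤ j := by omega
        simp [this]
    · simp only [rowAddBody, block, den, Store.setReg, Store.setCell]
      simp [e2, e3, e4, e5, e6, hd', hr', hc r hr' c]
  · rintro τ ⟨_, hr, hcd, hc⟩
    exact ⟨hr, fun j => by rw [hcd j, if_pos (Nat.zero_le _)], hc⟩

theorem haltsWith_clearRow {σ : Store} (hσ : Consts n T σ) :
    HaltsWith clearRow σ (n * 3 + 2) fun τ => (∀ r < 11, τ.reg r = σ.reg r) ∧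
      (∀ j : Fin n, τ.cell (T + 1 + n) j = 0) ∧
      ∀ r ≠ T + 1 + n, ∀ c, τ.cell r c = σ.cell r c := by
  refine (HaltsWith.forDown (K := 1) (fun m τ => τ.reg 11 = m ∧ (∀ r < 11, τ.reg r = σ.reg r) ∧
      (∀ j : Fin n, m ≤ j → τ.cell (T + 1 + n) j = 0) ∧
      ∀ r ≠ T + 1 + n, ∀ c, τ.cell r c = σ.cell r c) hσ.r0 hσ.r3 ?_ ?_ ?_).mono le_rfl ?_
  · refine ⟨by simp [Store.setReg], fun r hr => ?_, fun j hj => by omega, fun r _ c => rfl⟩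
    simp [Store.setReg, hr.ne]
  · intro m τ h
    exact ⟨h.1, by rw [h.2.1 2 (by omega), hσ.r2]⟩
  · rintro m hm τ ⟨_, hr, hcd, hc⟩
    refine HaltsWith.of_den (p := store 5 11 3) trivial ?_
    have h5 := (hr 5 (by omega)).trans hσ.r5
    have h3 := (hr 3 (by omega)).trans hσ.r3
    refine ⟨by simp [den, Store.setReg, Store.setCell], fun r hr' => ?_, fun j hj => ?_,
      fun r hr' c => ?_⟩
    · simp [den, Store.setReg, Store.setCell, hr'.ne, hr r hr']
    · simp only [den, Store.setReg, Store.setCell]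
      simp [h5, h3]
      by_cases hj' : (j : ℕ) = m
      · simp [hj']
      · rw [Function.update_of_ne hj', hcd j (by omega)]
    · simp [den, Store.setReg, Store.setCell, h5, hr', hc r hr' c]
  · rintro τ ⟨_, hr, hcd, hc⟩
    exact ⟨hr, fun j => hcd j (Nat.zero_le _), hc⟩

/-- The matrix `ℓ` is stored in the rows from `T + 1` on. -/
def StoresMatrix (T : ℕ) (ℓ : Matrix (Fin n) (Fin n) (ZMod 2)) (σ : Store) : Prop :=
  ∀ i j : Fin n, σ.cell (T + 1 + i) j = (ℓ i j).val

theorem haltsWith_initMatrix {σ : Store} (hσ : Consts n T σ)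
    (h0 : ∀ i j : Fin n, σ.cell (T + 1 + i) j = 0) :
    HaltsWith initMatrix σ (n * 4 + 2) fun τ => (∀ r < 7, τ.reg r = σ.reg r) ∧
      StoresMatrix T (1 : Matrix (Fin n) (Fin n) (ZMod 2)) τ ∧
      ∀ r < T + 1, ∀ c, τ.cell r c = σ.cell r c := by
  refine (HaltsWith.forDown (K := 2) (fun m τ => τ.reg 7 = m ∧ (∀ r < 7, τ.reg r = σ.reg r) ∧
      (∀ i j : Fin n, τ.cell (T + 1 + i) j = if m ≤ i ∧ i = j then 1 else 0) ∧
      ∀ r < T + 1, ∀ c, τ.cell r c = σ.cell r c) hσ.r0 hσ.r3 ?_ ?_ ?_).mono le_rfl ?_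
  · refine ⟨by simp [Store.setReg], fun r hr => ?_, fun i j => ?_, fun r _ c => rfl⟩
    · simp [Store.setReg, hr.ne]
    · rw [if_neg (by omega)]
      exact h0 i j
  · intro m τ h
    exact ⟨h.1, by rw [h.2.1 2 (by omega), hσ.r2]⟩
  · rintro m hm τ ⟨_, hr, hcd, hc⟩
    refine HaltsWith.of_den (p := .seq (add 8 4 7) (store 8 7 2)) (by simp [LoopFree]) ?_
    have h4 := (hr 4 (by omega)).trans hσ.r4
    have h2 := (hr 2 (by omega)).trans hσ.r2
    refine ⟨by simp [den, Store.setReg, Store.setCell], fun r hr' => ?_, fun i j => ?_,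
      fun r hr' c => ?_⟩
    · have e : r ≠ 8 := by omega
      simp [den, Store.setReg, Store.setCell, hr'.ne, e, hr r hr']
    · simp only [den, Store.setReg, Store.setCell]
      simp [h4, h2]
      by_cases hi : (i : ℕ) = m
      · by_cases hj : (j : ℕ) = m
        · have : i = j := Fin.ext (hi.trans hj.symm)
          simp [hj, this]
        · have hij : i ≠ j := fun h => hj (h ▸ hi)
          have := hcd i j
          rw [hi] at this
          simp [hi, hj, this, hij]
      · have : m + 1 ≤ i ↔ m ≤ i := by omega
        simp [hi, hcd i j, this]
    · have e : r ≠ T + 1 + m := by omega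
      simp [den, Store.setReg, Store.setCell, h4, e, hc r hr' c]
  · rintro τ ⟨_, hr, hcd, hc⟩
    refine ⟨hr, fun i j => ?_, hc⟩
    rw [hcd i j, Matrix.one_apply]
    simp only [Nat.zero_le, true_and]
    split_ifs <;> simp [ZMod.val_one]

theorem haltsWith_applyVector {σ : Store} (hσ : Consts n T σ) (ht : σ.reg 6 < T)
    {y : Fin n → ZMod 2} {ℓ : Matrix (Fin n) (Fin n) (ZMod 2)}
    (hy : ∀ i : Fin n, σ.cell (σ.reg 6) i - (1 - σ.cell (σ.reg 6) (n + i)) = (y i).val)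
    (hℓ : StoresMatrix T ℓ σ) (h0 : ∀ j : Fin n, σ.cell (T + 1 + n) j = 0) :
    HaltsWith applyVector σ (n * (n * 9 + 11) + 2) fun τ => (∀ r < 7, τ.reg r = σ.reg r) ∧
      (∀ j : Fin n, τ.cell (T + 1 + n) j = ((y ᵥ* ℓ) j).val) ∧
      ∀ r ≠ T + 1 + n, ∀ c, τ.cell r c = σ.cell r c := by
  refine (HaltsWith.forDown (K := 7 + (n * 9 + 2)) (fun m τ => τ.reg 7 = m ∧
      (∀ r < 7, τ.reg r = σ.reg r) ∧
      (∀ j : Fin n, τ.cell (T + 1 + n) j = (∑ i ∈ Finset.univ.filter fun i : Fin n => m ≤ (i : ℕ), y i * ℓ i j).val) ∧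
      ∀ r ≠ T + 1 + n, ∀ c, τ.cell r c = σ.cell r c) hσ.r0 hσ.r3 ?_ ?_ ?_).mono (by ring_nf; rfl) ?_
  · refine ⟨by simp [Store.setReg], fun r hr => ?_, fun j => ?_, fun r _ c => rfl⟩
    · simp [Store.setReg, hr.ne]
    · rw [Finset.filter_eq_empty_iff.2 fun i _ => by omega]
      exact h0 j
  · intro m τ h
    exact ⟨h.1, by rw [h.2.1 2 (by omega), hσ.r2]⟩
  · rintro m hm τ ⟨_, hr, hcd, hc⟩
    have h0 := (hr 0 (by omega)).trans hσ.r0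
    have h2 := (hr 2 (by omega)).trans hσ.r2
    have h4 := (hr 4 (by omega)).trans hσ.r4
    have h6 := hr 6 (by omega)
    have hyt := hy ⟨m, hm⟩
    rw [← hc _ (by omega), ← hc _ (by omega)] at hyt
    refine (HaltsWith.of_den (p := loadSinglet) (by simp [loadSinglet, block, LoopFree])
      (Q := fun ρ => ρ.reg 7 = m ∧ ρ.reg 8 = T + 1 + m ∧ ρ.reg 9 = 1 - (y ⟨m, hm⟩).val ∧
        (∀ r < 7, ρ.reg r = τ.reg r) ∧ ρ.cell = τ.cell) ?_).seq ?_
    · refine ⟨?_, ?_, ?_, fun r hr' => ?_, rfl⟩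
      · simp [loadSinglet, block, den, Store.setReg]
      · simp [loadSinglet, block, den, Store.setReg, h4]
      · simp [loadSinglet, block, den, Store.setReg, h2, h0, h6, ← hyt]
      · have g1 : r ≠ 7 := by omega
        have g2 : r ≠ 8 := by omega
        have g3 : r ≠ 9 := by omega
        have g4 : r ≠ 12 := by omega
        have g5 : r ≠ 13 := by omega
        have g6 : r ≠ 14 := by omega
        simp [loadSinglet, block, den, Store.setReg, g1, g2, g3, g4, g5, g6]
    · rintro ρ ⟨r7, r8, r9, hk, hcell⟩
      have hkσ : ∀ r < 7, ρ.reg r = σ.reg r := fun r hr' => (hk r hr').trans (hr r hr')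
      have hρ := hσ.congr (by omega) hkσ
      refine (haltsWith_rowAdd hρ (s := 8) (d := 5) (by omega) (by omega)
        (by rw [r8, hρ.r5]; omega) (u := ℓ ⟨m, hm⟩) r9 ?_
        (v := fun j => ∑ i ∈ Finset.univ.filter fun i : Fin n => m + 1 ≤ (i : ℕ), y i * ℓ i j) ?_).mono le_rfl ?_
      · intro j
        rw [r8, hcell, hc _ (by omega)]
        exact hℓ ⟨m, hm⟩ j
      · intro j
        rw [hρ.r5, hcell, hcd j]
      · rintro ρ' ⟨a1, a2, a3⟩
        rw [hρ.r5] at a2 a3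
        refine ⟨(a1 7 (by omega)).trans r7,
          fun r hr' => (a1 r (by omega)).trans (hkσ r hr'), fun j => ?_, fun r hr' c => ?_⟩
        · rw [a2 j]
          congr 1
          have : (Finset.univ.filter fun i : Fin n => m ≤ (i : ℕ)) =
              insert ⟨m, hm⟩ (Finset.univ.filter fun i : Fin n => m + 1 ≤ (i : ℕ)) := by
            ext i
            simp only [Finset.mem_filter, Finset.mem_univ, true_and, Finset.mem_insert,
              Fin.ext_iff]
            omega
          rw [this, Finset.sum_insert (by simp)]
          ring
        · rw [a3 r hr' c, hcell, hc r hr' c]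
  · rintro τ ⟨_, hr, hcd, hc⟩
    refine ⟨hr, fun j => ?_, hc⟩
    rw [hcd j]
    simp [Matrix.vecMul, dotProduct]

theorem haltsWith_findPivot {σ : Store} (hσ : Consts n T σ) {p : Fin n → ZMod 2}
    (hp : ∀ j : Fin n, σ.cell (T + 1 + n) j = (p j).val) :
    HaltsWith findPivot σ (n * 5 + 3) fun τ => (∀ r < 7, τ.reg r = σ.reg r) ∧
      τ.cell = σ.cell ∧ (0 < n → ∃ j : Fin n, τ.reg 10 = j ∧ (p = 0 ∨ p j = 1)) := by
  refine ((HaltsWith.of_den (p := const 10 0) trivial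
    (Q := fun ρ => ρ.reg 10 = 0 ∧ (∀ r < 7, ρ.reg r = σ.reg r) ∧ ρ.cell = σ.cell) ?_).seq
    (L := n * 5 + 2) ?_).mono (by simp only [cost]; omega) fun _ => id
  · refine ⟨by simp [den, Store.setReg], fun r hr => ?_, rfl⟩
    have : r ≠ 10 := by omega
    simp [den, Store.setReg, this]
  rintro ρ ⟨h10, hk, hcell⟩
  have hρ := hσ.congr (by omega) hk
  -- Either no nonzero entry has been met and register `10` keeps its default, or it points to an
  -- entry equal to one.
  refine (HaltsWith.forDown (K := 3) (fun m τ => τ.reg 11 = m ∧ (∀ r < 7, τ.reg r = σ.reg r) ∧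
      τ.cell = σ.cell ∧ ((τ.reg 10 = 0 ∧ ∀ j : Fin n, m ≤ j → p j = 0) ∨
        ∃ j : Fin n, τ.reg 10 = j ∧ p j = 1)) hρ.r0 hρ.r3 ?_ ?_ ?_).mono le_rfl ?_
  · refine ⟨by simp [Store.setReg], fun r hr => ?_, hcell, Or.inl ⟨?_, fun j hj => by omega⟩⟩
    · have : r ≠ 11 := by omega
      simp [Store.setReg, this, hk r hr]
    · simp [Store.setReg, h10]
  · intro m τ h
    exact ⟨h.1, by rw [h.2.1 2 (by omega), hσ.r2]⟩
  · rintro m hm τ ⟨_, hr, hc, hj⟩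
    refine HaltsWith.of_den (p := .seq (load 12 5 11) (ite 12 (add 10 11 3) (const 13 0)))
      (by simp [LoopFree]) ?_
    have h5 := (hr 5 (by omega)).trans hσ.r5
    have h3 := (hr 3 (by omega)).trans hσ.r3
    have hpm := hp ⟨m, hm⟩
    rcases zmod_two_cases (p ⟨m, hm⟩) with h | h
    · rw [h, ZMod.val_zero] at hpm
      have e : den (.seq (load 12 5 11) (ite 12 (add 10 11 3) (const 13 0))) (τ.setReg 11 m) =
          den (const 13 0) (den (load 12 5 11) (τ.setReg 11 m)) :=
        if_neg (by simpa [den, Store.setReg, h5, hc] using hpm)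
      rw [e]
      simp only [den]
      refine ⟨by simp [Store.setReg], fun r hr' => ?_, hc, ?_⟩
      · have g1 : r ≠ 11 := by omega
        have g2 : r ≠ 12 := by omega
        have g3 : r ≠ 13 := by omega
        simp [Store.setReg, g1, g2, g3, hr r hr']
      · rcases hj with ⟨h0, hj⟩ | ⟨j, h0, hj⟩
        · refine Or.inl ⟨by simp [Store.setReg, h0], fun j hmj => ?_⟩
          by_cases hjm : (j : ℕ) = m
          · obtain rfl : j = ⟨m, hm⟩ := Fin.ext hjm
            exact h
          · exact hj j (by omega)
        · exact Or.inr ⟨j, by simp [Store.setReg, h0], hj⟩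
    · rw [h, ZMod.val_one] at hpm
      have e : den (.seq (load 12 5 11) (ite 12 (add 10 11 3) (const 13 0))) (τ.setReg 11 m) =
          den (add 10 11 3) (den (load 12 5 11) (τ.setReg 11 m)) :=
        if_pos (by simpa [den, Store.setReg, h5, hc] using ne_of_eq_of_ne hpm one_ne_zero)
      rw [e]
      simp only [den]
      refine ⟨by simp [Store.setReg], fun r hr' => ?_, hc, ?_⟩
      · have g1 : r ≠ 11 := by omega
        have g2 : r ≠ 12 := by omega
        have g3 : r ≠ 10 := by omega
        simp [Store.setReg, g1, g2, g3, hr r hr']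
      · exact Or.inr ⟨⟨m, hm⟩, by simp [Store.setReg, h3], h⟩
  · rintro τ ⟨_, hr, hc, hj⟩
    refine ⟨hr, hc, fun hn => ?_⟩
    rcases hj with ⟨h0, hj⟩ | ⟨j, h0, hj⟩
    · exact ⟨⟨0, hn⟩, h0, Or.inl (funext fun j => hj j (Nat.zero_le _))⟩
    · exact ⟨j, h0, Or.inr hj⟩

/-- The update can be done in place: rows below the counter are untouched, so the pivot entry of
each row is read before that row changes. -/
theorem haltsWith_eliminate {σ : Store} (hσ : Consts n T σ) {p q : Fin n → ZMod 2}
    {ℓ : Matrix (Fin n) (Fin n) (ZMod 2)} (hℓ : StoresMatrix T ℓ σ)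
    (hp : ∀ j : Fin n, σ.cell (T + 1 + n) j = (p j).val)
    (hq : ∀ i : Fin n, σ.cell (T + 1 + i) (σ.reg 10) = (q i).val) :
    HaltsWith eliminate σ (n * (n * 9 + 7) + 2) fun τ => (∀ r < 7, τ.reg r = σ.reg r) ∧
      StoresMatrix T (ℓ + Matrix.vecMulVec q p) τ ∧
      ∀ r < T + 1, ∀ c, τ.cell r c = σ.cell r c := by
  refine (HaltsWith.forDown (K := 3 + (n * 9 + 2)) (fun m τ => τ.reg 7 = m ∧
      (∀ r < 7, τ.reg r = σ.reg r) ∧ τ.reg 10 = σ.reg 10 ∧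
      (∀ i j : Fin n, m ≤ i → τ.cell (T + 1 + i) j = (ℓ i j + p j * q i).val) ∧
      (∀ i : Fin n, (i : ℕ) < m → ∀ c, τ.cell (T + 1 + i) c = σ.cell (T + 1 + i) c) ∧
      (∀ c, τ.cell (T + 1 + n) c = σ.cell (T + 1 + n) c) ∧
      ∀ r < T + 1, ∀ c, τ.cell r c = σ.cell r c) hσ.r0 hσ.r3 ?_ ?_ ?_).mono (by ring_nf; rfl) ?_
  · refine ⟨by simp [Store.setReg], fun r hr => ?_, by simp [Store.setReg],
      fun i j h => by omega, fun i _ c => rfl, fun c => rfl, fun r _ c => rfl⟩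
    simp [Store.setReg, hr.ne]
  · intro m τ h
    exact ⟨h.1, by rw [h.2.1 2 (by omega), hσ.r2]⟩
  · rintro m hm τ ⟨_, hr, h10, hge, hlt, hP, hc⟩
    have h2 := (hr 2 (by omega)).trans hσ.r2
    have h4 := (hr 4 (by omega)).trans hσ.r4
    have hqm := (hlt ⟨m, hm⟩ (Nat.lt_succ_self m) (σ.reg 10)).trans (hq ⟨m, hm⟩)
    simp only at hqm
    refine (HaltsWith.of_den (p := loadPivot) (by simp [loadPivot, block, LoopFree])
      (Q := fun ρ => ρ.reg 7 = m ∧ ρ.reg 8 = T + 1 + m ∧ ρ.reg 9 = 1 - (q ⟨m, hm⟩).val ∧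
        ρ.reg 10 = σ.reg 10 ∧ (∀ r < 7, ρ.reg r = τ.reg r) ∧ ρ.cell = τ.cell) ?_).seq ?_
    · refine ⟨?_, ?_, ?_, ?_, fun r hr' => ?_, rfl⟩
      · simp [loadPivot, block, den, Store.setReg]
      · simp [loadPivot, block, den, Store.setReg, h4]
      · simp [loadPivot, block, den, Store.setReg, h2, h4, h10, hqm]
      · simp [loadPivot, block, den, Store.setReg, h10]
      · have g1 : r ≠ 7 := by omega
        have g2 : r ≠ 8 := by omega
        have g3 : r ≠ 9 := by omega
        simp [loadPivot, block, den, Store.setReg, g1, g2, g3]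
    · rintro ρ ⟨r7, r8, r9, r10, hk, hcell⟩
      have hkσ : ∀ r < 7, ρ.reg r = σ.reg r := fun r hr' => (hk r hr').trans (hr r hr')
      have hρ := hσ.congr (by omega) hkσ
      refine (haltsWith_rowAdd hρ (s := 5) (d := 8) (by omega) (by omega)
        (by rw [r8, hρ.r5]; omega) (u := p) r9 ?_ (v := ℓ ⟨m, hm⟩) ?_).mono le_rfl ?_
      · intro j
        rw [hρ.r5, hcell, hP, hp j]
      · intro j
        rw [r8, hcell]
        exact (hlt ⟨m, hm⟩ (Nat.lt_succ_self m) j).trans (hℓ ⟨m, hm⟩ j)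
      · rintro ρ' ⟨a1, a2, a3⟩
        rw [r8] at a2 a3
        refine ⟨(a1 7 (by omega)).trans r7, fun r hr' => (a1 r (by omega)).trans (hkσ r hr'),
          (a1 10 (by omega)).trans r10, fun i j hi => ?_, fun i hi c => ?_, fun c => ?_,
          fun r hr' c => ?_⟩
        · by_cases him : (i : ℕ) = m
          · obtain rfl : i = ⟨m, hm⟩ := Fin.ext him
            exact a2 j
          · rw [a3 _ (by omega), hcell, hge i j (by omega)]
        · rw [a3 _ (by omega), hcell, hlt i (by omega)]
        · rw [a3 _ (by omega), hcell, hP]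
        · rw [a3 _ (by omega), hcell, hc r hr']
  · rintro τ ⟨_, hr, _, hge, _, _, hc⟩
    refine ⟨hr, fun i j => ?_, hc⟩
    rw [hge i j (Nat.zero_le _), Matrix.add_apply, Matrix.vecMulVec_apply, mul_comm]

/-- One round: the range of the stored matrix is intersected with the complement of `y`. -/
theorem haltsWith_processRound {σ : Store} (hσ : Consts n T σ) (ht : σ.reg 6 < T)
    {y : Fin n → ZMod 2} {ℓ : Matrix (Fin n) (Fin n) (ZMod 2)}
    (hy : ∀ i : Fin n, σ.cell (σ.reg 6) i - (1 - σ.cell (σ.reg 6) (n + i)) = (y i).val)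
    (hℓ : StoresMatrix T ℓ σ) :
    HaltsWith processRound σ (18 * n ^ 2 + 26 * n + 9) fun τ => (∀ r < 7, τ.reg r = σ.reg r) ∧
      (∀ r < T + 1, ∀ c, τ.cell r c = σ.cell r c) ∧
      ∃ ℓ' : Matrix (Fin n) (Fin n) (ZMod 2), StoresMatrix T ℓ' τ ∧
        ∀ x, (∃ a, ℓ' *ᵥ a = x) ↔ (∃ a, ℓ *ᵥ a = x) ∧ y ⬝ᵥ x = 0 := by
  refine (HaltsWith.seq (haltsWith_clearRow hσ) (L := _) fun σ1 ⟨k1, z1, c1⟩ =>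
    HaltsWith.seq (haltsWith_applyVector (hσ.congr (by omega) k1) (y := y) (ℓ := ℓ)
      (by rwa [k1 6 (by omega)]) ?_ ?_ z1) fun σ2 ⟨k2, v2, c2⟩ =>
    HaltsWith.seq (haltsWith_findPivot ((hσ.congr (by omega) k1).congr (by omega) k2) v2)
      fun σ3 ⟨k3, c3, p3⟩ => ?_).mono (K := n * 3 + 2 + ((n * (n * 9 + 11) + 2) +
        ((n * 5 + 3) + (n * (n * 9 + 7) + 2)))) (by ring_nf; rfl) fun _ => id
  · intro i
    rw [k1 6 (by omega), c1 _ (by omega), c1 _ (by omega)]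
    exact hy i
  · intro i j
    rw [c1 _ (by omega)]
    exact hℓ i j
  · have hσ3 := ((hσ.congr (by omega) k1).congr (by omega) k2).congr (by omega) k3
    have hreg : ∀ r < 7, σ3.reg r = σ.reg r := fun r hr =>
      (k3 r hr).trans ((k2 r hr).trans (k1 r (by omega)))
    have hℓ3 : StoresMatrix T ℓ σ3 := by
      intro i j
      rw [c3, c2 _ (by omega), c1 _ (by omega)]
      exact hℓ i j
    have hc3 : ∀ r < T + 1, ∀ c, σ3.cell r c = σ.cell r c := by
      intro r hr c
      rw [c3, c2 _ (by omega), c1 _ (by omega)]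
    obtain ⟨q, hq, hrange⟩ : ∃ q : Fin n → ZMod 2,
        (∀ i : Fin n, σ3.cell (T + 1 + i) (σ3.reg 10) = (q i).val) ∧
        ∀ x, (∃ a, (ℓ + Matrix.vecMulVec q (y ᵥ* ℓ)) *ᵥ a = x) ↔
          (∃ a, ℓ *ᵥ a = x) ∧ y ⬝ᵥ x = 0 := by
      -- Without qubits there is no pivot index, but then all vectors coincide.
      rcases Nat.eq_zero_or_pos n with hn | hn
      · subst hn
        refine ⟨0, fun i => i.elim0, fun x => ?_⟩
        have : ∀ a b : Fin 0 → ZMod 2, a = b := fun a b => Subsingleton.elim a b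
        exact ⟨fun _ => ⟨⟨0, this _ _⟩, by simp [dotProduct]⟩, fun _ => ⟨0, this _ _⟩⟩
      · obtain ⟨j, hj, hpj⟩ := p3 hn
        refine ⟨fun i => ℓ i j, fun i => by rw [hj]; exact hℓ3 i j, fun x => ?_⟩
        exact range_add_vecMulVec ℓ y j hpj x
    refine (haltsWith_eliminate hσ3 hℓ3 (p := y ᵥ* ℓ) (fun j => by rw [c3]; exact v2 j) hq).mono
      le_rfl ?_
    rintro τ ⟨a1, a2, a3⟩
    exact ⟨fun r hr => (a1 r hr).trans (hreg r hr),
      fun r hr c => (a3 r hr c).trans (hc3 r hr c), _, a2, hrange⟩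

/-- Horner's scheme from the highest digit: register `9` times `2 ^ m` is the part of the sum from
`m` on. -/
theorem haltsWith_binary {σ : Store} (hσ : Consts n T σ) (h9 : σ.reg 9 = 0) :
    HaltsWith (forDown 11 0 (block (add 9 9 9) [load 12 8 11, add 9 9 12])) σ (n * 5 + 2)
      fun τ => (∀ r < 9, τ.reg r = σ.reg r) ∧ τ.cell = σ.cell ∧
        τ.reg 9 = ∑ j ∈ Finset.range n, σ.cell (σ.reg 8) j * 2 ^ j := by
  refine (HaltsWith.forDown (K := 3) (fun m τ => τ.reg 11 = m ∧ (∀ r < 9, τ.reg r = σ.reg r) ∧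
      τ.cell = σ.cell ∧
      τ.reg 9 * 2 ^ m = ∑ j ∈ Finset.Ico m n, σ.cell (σ.reg 8) j * 2 ^ j)
    hσ.r0 hσ.r3 ?_ ?_ ?_).mono le_rfl ?_
  · refine ⟨by simp [Store.setReg], fun r hr => ?_, rfl, by simp [Store.setReg, h9]⟩
    have : r ≠ 11 := by omega
    simp [Store.setReg, this]
  · intro m τ h
    exact ⟨h.1, by rw [h.2.1 2 (by omega), hσ.r2]⟩
  · rintro m hm τ ⟨_, hr, hc, hsum⟩
    refine HaltsWith.of_den (p := block (add 9 9 9) [load 12 8 11, add 9 9 12])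
      (by simp [block, LoopFree]) ?_
    have h8 := hr 8 (by omega)
    refine ⟨by simp [block, den, Store.setReg], fun r hr' => ?_, hc, ?_⟩
    · have g1 : r ≠ 11 := by omega
      have g2 : r ≠ 12 := by omega
      simp [block, den, Store.setReg, g1, g2, hr'.ne, hr r hr']
    · rw [Finset.sum_eq_sum_Ico_succ_bot hm, ← hsum]
      simp [block, den, Store.setReg, hc, h8]
      ring
  · rintro τ ⟨_, hr, hc, hsum⟩
    refine ⟨hr, hc, ?_⟩
    rw [← Nat.Ico_zero_eq_range, ← hsum, pow_zero, mul_one]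

/-- Writing labels changes row `0` only, so the matrix rows still to be read stay intact. -/
theorem haltsWith_labels {σ : Store} (hσ : Consts n T σ)
    {ℓ : Matrix (Fin n) (Fin n) (ZMod 2)} (hℓ : StoresMatrix T ℓ σ) :
    HaltsWith (forDown 7 0 labelRow) σ (n * (n * 5 + 7) + 2) fun τ =>
      ∀ i : Fin n, τ.cell 0 i = ∑ j : Fin n, (ℓ i j).val * 2 ^ (j : ℕ) := by
  refine (HaltsWith.forDown (K := 2 + (n * 5 + 2 + 1)) (fun m τ => τ.reg 7 = m ∧
      (∀ r < 7, τ.reg r = σ.reg r) ∧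
      (∀ i : Fin n, m ≤ i → τ.cell 0 i = ∑ j : Fin n, (ℓ i j).val * 2 ^ (j : ℕ)) ∧
      ∀ r ≠ 0, ∀ c, τ.cell r c = σ.cell r c) hσ.r0 hσ.r3 ?_ ?_ ?_).mono (by ring_nf; rfl) ?_
  · refine ⟨by simp [Store.setReg], fun r hr => ?_, fun i hi => by omega, fun r _ c => rfl⟩
    simp [Store.setReg, hr.ne]
  · intro m τ h
    exact ⟨h.1, by rw [h.2.1 2 (by omega), hσ.r2]⟩
  · rintro m hm τ ⟨_, hr, hlab, hc⟩
    have h4 := (hr 4 (by omega)).trans hσ.r4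
    refine (HaltsWith.of_den (p := .seq (add 8 4 7) (const 9 0)) (by simp [LoopFree])
      (Q := fun ρ => ρ.reg 7 = m ∧ ρ.reg 8 = T + 1 + m ∧ ρ.reg 9 = 0 ∧
        (∀ r < 7, ρ.reg r = τ.reg r) ∧ ρ.cell = τ.cell) ?_).seq ?_
    · refine ⟨?_, ?_, ?_, fun r hr' => ?_, rfl⟩
      · simp [den, Store.setReg]
      · simp [den, Store.setReg, h4]
      · simp [den, Store.setReg]
      · have g1 : r ≠ 7 := by omega
        have g2 : r ≠ 8 := by omega
        have g3 : r ≠ 9 := by omega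
        simp [den, Store.setReg, g1, g2, g3]
    rintro ρ ⟨r7, r8, r9, hk, hcell⟩
    have hkσ : ∀ r < 7, ρ.reg r = σ.reg r := fun r hr' => (hk r hr').trans (hr r hr')
    have hρ := hσ.congr (by omega) hkσ
    refine (haltsWith_binary hρ r9).seq ?_
    rintro ρ' ⟨a1, a2, a3⟩
    refine HaltsWith.of_den (p := store 3 7 9) trivial ?_
    have h3 := (a1 3 (by omega)).trans hρ.r3
    have h7 := (a1 7 (by omega)).trans r7
    have h9 : ρ'.reg 9 = ∑ j : Fin n, (ℓ ⟨m, hm⟩ j).val * 2 ^ (j : ℕ) := by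
      rw [a3, r8, hcell, ← Fin.sum_univ_eq_sum_range fun j => τ.cell (T + 1 + m) j * 2 ^ j]
      refine Finset.sum_congr rfl fun j _ => ?_
      rw [hc _ (by omega)]
      congr 1
      exact hℓ ⟨m, hm⟩ j
    refine ⟨h7, fun r hr' => (a1 r (by omega)).trans (hkσ r hr'), fun i hi => ?_,
      fun r hr' c => ?_⟩
    · simp only [den, Store.setCell, h3, h7, Function.update_self]
      by_cases him : (i : ℕ) = m
      · obtain rfl : i = ⟨m, hm⟩ := Fin.ext him
        simp [h9]
      · rw [Function.update_of_ne him, a2, hcell, hlab i (by omega)]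
    · simp only [den, Store.setCell, h3, h7]
      rw [Function.update_of_ne hr', a2, hcell, hc r hr']
  · rintro τ ⟨_, _, hlab, _⟩
    exact fun i => hlab i (Nat.zero_le _)

/-- For bits, `a - (1 - b)` in truncated subtraction is the conjunction, and the singlet has both
Bell labels equal to one. -/
theorem input_cell_singlet (ω : Outcomes n T) (t : Fin T) (i : Fin n) :
    (input ω).cell t i - (1 - (input ω).cell t (n + i)) = (singletPattern (ω t) i).val := by
  simp [input, singletPattern]
  cases ω t (0, i) <;> cases ω t (1, i) <;> simp [ZMod.val_one]

theorem input_cell_of_le (ω : Outcomes n T) {r : ℕ} (hr : T ≤ r) (c : ℕ) :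
    (input ω).cell r c = 0 := by
  simp [input, hr]

/-- A bound on the running time of the program. -/
def cutProgramTime (n T : ℕ) : ℕ :=
  4 + (n * 4 + 2 + (T * (18 * n ^ 2 + 26 * n + 11) + 2 + (n * (n * 5 + 7) + 2)))

theorem haltsWith_cutProgram (ω : Outcomes n T) :
    HaltsWith cutProgram (input ω) (cutProgramTime n T) fun τ =>
      ∃ ℓ : Matrix (Fin n) (Fin n) (ZMod 2),
        (∀ x, (∃ a, ℓ *ᵥ a = x) ↔ ∀ t, singletPattern (ω t) ⬝ᵥ x = 0) ∧
        ∀ i : Fin n, τ.cell 0 i = ∑ j : Fin n, (ℓ i j).val * 2 ^ (j : ℕ) := by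
  refine (HaltsWith.of_den (p := initConstants) (by simp [initConstants, block, LoopFree])
    (Q := fun σ => Consts n T σ ∧ σ.cell = (input ω).cell) ?_).seq ?_
  · refine ⟨⟨?_, ?_, ?_, ?_, ?_, ?_⟩, rfl⟩ <;>
      simp [initConstants, block, den, Store.setReg, input]
  rintro σ0 ⟨hσ0, hc0⟩
  refine HaltsWith.seq (haltsWith_initMatrix hσ0 fun i j => ?_) ?_
  · rw [hc0, input_cell_of_le ω (by omega)]
  rintro σ ⟨hk, h1, hc⟩
  have hσ := hσ0.congr (by omega) hk
  rw [hc0] at hc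
  refine HaltsWith.seq (Q := fun τ => Consts n T τ ∧ ∃ ℓ : Matrix (Fin n) (Fin n) (ZMod 2),
    StoresMatrix T ℓ τ ∧ ∀ x, (∃ a, ℓ *ᵥ a = x) ↔ ∀ t, singletPattern (ω t) ⬝ᵥ x = 0) ?_ ?_
  -- The range is the complement of the patterns of the rounds from `m` on; it starts as the whole
  -- space, the range of the identity.
  · refine (HaltsWith.forDown (K := 18 * n ^ 2 + 26 * n + 9) (fun m τ => τ.reg 6 = m ∧
      (∀ r < 6, τ.reg r = σ.reg r) ∧ (∀ r < T + 1, ∀ c, τ.cell r c = (input ω).cell r c) ∧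
      ∃ ℓ : Matrix (Fin n) (Fin n) (ZMod 2), StoresMatrix T ℓ τ ∧ ∀ x, (∃ a, ℓ *ᵥ a = x) ↔
        ∀ t : Fin T, m ≤ t → singletPattern (ω t) ⬝ᵥ x = 0) hσ.r1 hσ.r3 ?_ ?_ ?_).mono le_rfl ?_
    · refine ⟨by simp [Store.setReg], fun r hr => ?_, hc, 1, h1, fun x => ?_⟩
      · simp [Store.setReg, hr.ne]
      · exact ⟨fun _ t ht => by omega, fun _ => ⟨x, Matrix.one_mulVec x⟩⟩
    · intro m τ h
      exact ⟨h.1, by rw [h.2.1 2 (by omega), hσ.r2]⟩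
    · rintro m hm τ ⟨_, hr, hcτ, ℓ, hℓ, hrange⟩
      have hkτ : ∀ r < 6, (τ.setReg 6 m).reg r = σ.reg r := by
        intro r hr'
        simp [Store.setReg, hr'.ne, hr r hr']
      have h6 : (τ.setReg 6 m).reg 6 = m := by simp [Store.setReg]
      refine (haltsWith_processRound (hσ.congr le_rfl hkτ) (by rwa [h6])
        (y := singletPattern (ω ⟨m, hm⟩)) (ℓ := ℓ) (fun i => ?_) hℓ).mono le_rfl ?_
      · rw [h6, ← input_cell_singlet ω ⟨m, hm⟩ i, ← hcτ m (by omega), ← hcτ m (by omega)]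
        rfl
      · rintro ρ ⟨a1, a2, ℓ', hℓ', hrange'⟩
        refine ⟨(a1 6 (by omega)).trans h6, fun r hr' => (a1 r (by omega)).trans (hkτ r hr'),
          fun r hr' c => (a2 r hr' c).trans (hcτ r hr' c), ℓ', hℓ', fun x => ?_⟩
        rw [hrange', hrange]
        constructor
        · rintro ⟨h, h'⟩ t ht
          by_cases htm : (t : ℕ) = m
          · obtain rfl : t = ⟨m, hm⟩ := Fin.ext htm
            exact h'
          · exact h t (by omega)
        · exact fun h => ⟨fun t ht => h t (by omega), h _ le_rfl⟩
    · rintro τ ⟨_, hr, _, ℓ, hℓ, hrange⟩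
      exact ⟨hσ.congr le_rfl hr, ℓ, hℓ, fun x => by simpa using hrange x⟩
  · rintro τ ⟨hτ, ℓ, hℓ, hrange⟩
    exact (haltsWith_labels hτ hℓ).mono le_rfl fun ρ hρ => ⟨ℓ, hrange, hρ⟩

/-! ### From row labels to the partition, and the polynomial time bound. -/

theorem binary_injective (n : ℕ) (f g : Fin n → ZMod 2)
    (h : ∑ j : Fin n, (f j).val * 2 ^ (j : ℕ) = ∑ j : Fin n, (g j).val * 2 ^ (j : ℕ)) : f = g := by
  induction n with
  | zero => exact Subsingleton.elim _ _
  | succ n ih =>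
    have key : ∀ f : Fin (n + 1) → ZMod 2, ∑ j, (f j).val * 2 ^ (j : ℕ) =
        (f 0).val + 2 * ∑ j : Fin n, (f j.succ).val * 2 ^ (j : ℕ) := by
      intro f
      rw [Fin.sum_univ_succ, Finset.mul_sum]
      simp only [Fin.val_zero, pow_zero, mul_one, Fin.val_succ, pow_succ]
      congr 1
      exact Finset.sum_congr rfl fun j _ => by ring
    rw [key, key] at h
    have hf := ZMod.val_lt (f 0)
    have hg := ZMod.val_lt (g 0)
    have h0 : f 0 = g 0 := ZMod.val_injective 2 (by omega)
    have hs := ih (fun j => f j.succ) (fun j => g j.succ) (by omega)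
    funext j
    refine Fin.cases h0 (fun j => congrFun hs j) j

/-- The support of a vector over `ℤ₂`. -/
def zsupport (x : Fin n → ZMod 2) : Finset (Fin n) := Finset.univ.filter fun i => x i = 1

theorem mem_zsupport {x : Fin n → ZMod 2} {i : Fin n} : i ∈ zsupport x ↔ x i = 1 := by
  simp [zsupport]

/-- The program is correct if the singlet patterns determine the unions of blocks. -/
theorem outputs_cutProgram {ω : Outcomes n T} {P : Finpartition (Finset.univ : Finset (Fin n))}
    (h : ∀ x : Fin n → ZMod 2, (∀ t, singletPattern (ω t) ⬝ᵥ x = 0) ↔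
      ∃ F ⊆ P.parts, zsupport x = F.biUnion id) : Outputs cutProgram ω P := by
  obtain ⟨τ, k, hk, -, ℓ, hℓ, hlab⟩ := haltsWith_cutProgram ω
  refine ⟨τ, k, hk, fun i j => ?_⟩
  rw [hlab, hlab]
  constructor
  · intro hij
    have hrow := binary_injective n _ _ hij
    -- Equal rows force equal entries at `i` and `j` in every vector of the range, in particular in
    -- the indicator of the block of `i`.
    have hx : ∃ F ⊆ P.parts, zsupport (fun k => if k ∈ P.part i then (1 : ZMod 2) else 0) =
        F.biUnion id := by
      refine ⟨{P.part i}, by simp, ?_⟩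
      ext k
      simp [mem_zsupport]
    obtain ⟨a, ha⟩ := (hℓ _).2 ((h _).2 hx)
    have hi := congrFun ha i
    have hj := congrFun ha j
    rw [Matrix.mulVec, dotProduct, hrow] at hi
    rw [Matrix.mulVec, dotProduct, hi] at hj
    rw [if_pos (P.mem_part (Finset.mem_univ i))] at hj
    have hji : j ∈ P.part i := by
      by_contra hc
      rw [if_neg hc] at hj
      exact one_ne_zero hj
    exact (P.part_eq_of_mem (P.part_mem.2 (Finset.mem_univ i)) hji).symm
  · intro hij
    refine Finset.sum_congr rfl fun k _ => ?_
    -- Column `k` lies in the range, so it is the indicator of a union of blocks and hence constant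
    -- on each block.
    obtain ⟨F, hF, hx⟩ := (h _).1 ((hℓ (ℓ *ᵥ Pi.single k 1)).1 ⟨_, rfl⟩)
    have hmem : ∀ i, ℓ i k = 1 ↔ ∃ B ∈ F, i ∈ B := by
      intro i
      have := Finset.ext_iff.1 hx i
      simpa [mem_zsupport] using this
    have hpart : ∀ i, ℓ i k = 1 ↔ P.part i ∈ F := by
      intro i
      rw [hmem]
      constructor
      · rintro ⟨B, hB, hi⟩
        rwa [P.part_eq_of_mem (hF hB) hi]
      · exact fun hB => ⟨_, hB, P.mem_part (Finset.mem_univ i)⟩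
    have hiff : ℓ i k = 1 ↔ ℓ j k = 1 := by rw [hpart, hpart, hij]
    have heq : ℓ i k = ℓ j k := by
      rcases zmod_two_cases (ℓ j k) with h1 | h1
      · refine ((zmod_two_cases _).resolve_right fun h0 => ?_).trans h1.symm
        exact zero_ne_one (h1.symm.trans (hiff.1 h0))
      · exact (hiff.2 h1).trans h1.symm
    rw [heq]

theorem exists_time_bound : ∃ time : Polynomial ℕ, ∀ n T k : ℕ, k ≤ cutProgramTime n T →
    runtime n T k ≤ time.eval (n + T) := by
  refine ⟨100 * (Polynomial.X + 1) ^ 3, fun n T k hk => ?_⟩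
  simp only [runtime, bellCircuit_size, Polynomial.eval_mul, Polynomial.eval_pow,
    Polynomial.eval_add, Polynomial.eval_X, Polynomial.eval_one, Polynomial.eval_ofNat]
  refine (Nat.add_le_add_left hk _).trans ?_
  -- The slack of the generous cubic bound, written out as a polynomial with nonnegative
  -- coefficients.
  have h : 100 * (n + T + 1) ^ 3 = T * (2 * n + 2 * n) + cutProgramTime n T +
      (100 * n ^ 3 + 282 * n ^ 2 * T + 300 * n * T ^ 2 + 100 * T ^ 3 + 295 * n ^ 2 +
        570 * n * T + 300 * T ^ 2 + 289 * n + 289 * T + 90) := by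
    simp only [cutProgramTime]
    ring
  omega

end Program

/-! ### The success probability -/

section Probability

variable {n : ℕ}

theorem swapGate_pow_apply (z : ZMod 2) (u v : Bool × Bool) :
    (swapGate ^ z.val) u v = if v = (if z = 1 then u.swap else u) then 1 else 0 := by
  rcases zmod_two_cases z with rfl | rfl
  · simp [Matrix.one_apply, eq_comm]
  · simp only [ZMod.val_one, pow_one, swapGate, if_true]
    congr 1
    rw [eq_iff_iff]
    constructor <;> (rintro rfl; simp)

/-- `swapRep x` is a permutation matrix: for each `u` the only contributing `v` is `u` with the
copies exchanged on the support of `x`. -/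
theorem sum_swapRep_mul (x : Fin n → ZMod 2) (ψ : Amp (Fin n)) :
    ∑ u, ∑ v, swapRep x u v * (twoCopies ψ u * star (twoCopies ψ v)) =
      swapExp ψ (zsupport x) := by
  rw [swapExp_eq_sum_pairs, ← (pairEquiv n).sum_comp]
  refine Finset.sum_congr rfl fun u _ => ?_
  have h : ∀ v, swapRep x u v =
      if pairEquiv n v = fun i => if x i = 1 then (pairEquiv n u i).swap else pairEquiv n u i
      then 1 else 0 := by
    intro v
    simp only [swapRep, swapGate_pow_apply, Fintype.prod_boole, funext_iff]
    congr 1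
  rw [Finset.sum_eq_single ((pairEquiv n).symm
    fun i => if x i = 1 then (pairEquiv n u i).swap else pairEquiv n u i)]
  · rw [h, Equiv.apply_symm_apply, if_pos rfl, one_mul]
    have h0 : ∀ i, (pairEquiv n).symm (fun i => if x i = 1 then (pairEquiv n u i).swap
        else pairEquiv n u i) (0, i) = if x i = 1 then u (1, i) else u (0, i) := by
      intro i
      by_cases hi : x i = 1 <;> simp [pairEquiv, hi]
    have h1 : ∀ i, (pairEquiv n).symm (fun i => if x i = 1 then (pairEquiv n u i).swap
        else pairEquiv n u i) (1, i) = if x i = 1 then u (0, i) else u (1, i) := by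
      intro i
      by_cases hi : x i = 1 <;> simp [pairEquiv, hi]
    simp only [twoCopies, h0, h1, star_mul', mix_def, mem_zsupport, mul_assoc]
    rfl
  · intro v _ hv
    rw [h, if_neg, zero_mul]
    rintro h'
    exact hv (by rw [← h', Equiv.symm_apply_apply])
  · simp

/-- The distribution of the outcomes of one round. -/
noncomputable def bellProb (ψ : Amp (Fin n)) (s : TwoCopies n → Bool) : ℝ :=
  (bellCircuit n).prob (twoCopies ψ) s

theorem bellProb_nonneg (ψ : Amp (Fin n)) (s : TwoCopies n → Bool) : 0 ≤ bellProb ψ s :=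
  sq_nonneg _

theorem bellProb_eq_sum (ψ : Amp (Fin n)) (s : TwoCopies n → Bool) :
    (bellProb ψ s : ℂ) =
      ∑ u, ∑ v, (bellCircuit n).effect s u v * (twoCopies ψ u * star (twoCopies ψ v)) := by
  rw [bellProb, Circuit.prob, Complex.ofReal_pow, ← Complex.mul_conj', Matrix.mulVec, dotProduct,
    map_sum, Finset.sum_mul_sum]
  refine Finset.sum_congr rfl fun u _ => Finset.sum_congr rfl fun v _ => ?_
  rw [bellCircuit_effect, ketbra, Matrix.vecMulVec_apply, Pi.star_apply, star_bellBasis,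
    bellCircuit_matrix_apply, bellCircuit_matrix_apply, starRingEnd_apply, star_mul',
    star_bellBasis]
  ring

/-- The Fourier transform of the distribution of singlet patterns is the purity; this links the
samples to the hidden partition. -/
theorem sum_sgn_mul_bellProb (ψ : Amp (Fin n)) (x : Fin n → ZMod 2) :
    ∑ s, sgn (singletPattern s ⬝ᵥ x) * (bellProb ψ s : ℂ) = purity ψ (zsupport x) := by
  rw [← swapExp_eq_purity, ← sum_swapRep_mul, ← sum_character_effect]
  simp only [bellProb_eq_sum, Finset.mul_sum, Matrix.sum_apply, Matrix.smul_apply, Finset.sum_mul]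
  rw [Finset.sum_comm]
  refine Finset.sum_congr rfl fun u _ => ?_
  rw [Finset.sum_comm]
  refine Finset.sum_congr rfl fun v _ => Finset.sum_congr rfl fun s _ => ?_
  rw [character_eq_sgn, smul_eq_mul, mul_assoc]

theorem sum_bellProb {ψ : Amp (Fin n)} (hψ : IsStateVector ψ) : ∑ s, bellProb ψ s = 1 := by
  have h := sum_sgn_mul_bellProb ψ 0
  have h0 : zsupport (0 : Fin n → ZMod 2) = ∅ := by
    ext i
    simp [mem_zsupport]
  rw [h0, purity_eq_one hψ (Or.inl rfl)] at h
  simp only [dotProduct_zero, sgn_zero, one_mul] at h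
  exact_mod_cast h

theorem sum_bellProb_filter {ψ : Amp (Fin n)} (hψ : IsStateVector ψ) (x : Fin n → ZMod 2) :
    ∑ s, (if singletPattern s ⬝ᵥ x = 0 then bellProb ψ s else 0) =
      (1 + purity ψ (zsupport x)) / 2 := by
  have h1 : (∑ s, bellProb ψ s : ℂ) = 1 := by exact_mod_cast sum_bellProb hψ
  have h : ((∑ s, (if singletPattern s ⬝ᵥ x = 0 then bellProb ψ s else 0) : ℝ) : ℂ) =
      (((1 + purity ψ (zsupport x)) / 2 : ℝ) : ℂ) := by
    push_cast
    rw [← sum_sgn_mul_bellProb, ← h1, ← Finset.sum_add_distrib, Finset.sum_div]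
    refine Finset.sum_congr rfl fun s _ => ?_
    rcases zmod_two_cases (singletPattern s ⬝ᵥ x) with hs | hs
    · rw [hs, if_pos rfl, sgn_zero]
      ring
    · rw [hs, if_neg one_ne_zero, sgn_one]
      simp
  exact_mod_cast h

/-- At purity one the orthogonal patterns carry all the probability, so each other outcome has none.
-/
theorem bellProb_eq_zero {ψ : Amp (Fin n)} (hψ : IsStateVector ψ) {x : Fin n → ZMod 2}
    (hx : purity ψ (zsupport x) = 1) {s : TwoCopies n → Bool}
    (hs : singletPattern s ⬝ᵥ x ≠ 0) : bellProb ψ s = 0 := by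
  have h := sum_bellProb_filter hψ x
  rw [hx] at h
  have h1 : ∑ s, (bellProb ψ s - if singletPattern s ⬝ᵥ x = 0 then bellProb ψ s else 0) = 0 := by
    rw [Finset.sum_sub_distrib, h, sum_bellProb hψ]
    norm_num
  have h2 := (Finset.sum_eq_zero_iff_of_nonneg fun s _ => ?_).1 h1 s (Finset.mem_univ s)
  · rwa [if_neg hs, sub_zero] at h2
  · split_ifs
    · simp
    · simpa using bellProb_nonneg ψ s

variable {T : ℕ}

open Classical in
theorem one_sub_le_successProb {ε : ℝ} (hε : 0 < ε) (hε1 : ε ≤ 1) {ψ : Amp (Fin n)}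
    {P : Finpartition (Finset.univ : Finset (Fin n))} (h : IsHiddenManyCut ε ψ P) :
    1 - 2 ^ n * (1 - ε ^ 2 / 2) ^ T ≤ successProb cutProgram T ψ P := by
  set bad : Finset (Fin n → ZMod 2) :=
    Finset.univ.filter fun x => ¬ ∃ F ⊆ P.parts, zsupport x = F.biUnion id with hbad
  set miss : (Fin n → ZMod 2) → Outcomes n T → ℝ := fun x ω =>
    if ∀ t, singletPattern (ω t) ⬝ᵥ x = 0 then ∏ t, bellProb ψ (ω t) else 0 with hmiss
  have hprod : ∀ ω : Outcomes n T, 0 ≤ ∏ t, bellProb ψ (ω t) :=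
    fun ω => Finset.prod_nonneg fun t _ => bellProb_nonneg ψ _
  have hmiss0 : ∀ x ω, 0 ≤ miss x ω := by
    intro x ω
    simp only [hmiss]
    split_ifs
    exacts [hprod ω, le_rfl]
  -- The union bound outcome by outcome: if the output is wrong and `ω` has positive probability,
  -- unions of blocks pass all tests, so some bad `x` passes them too and its term cancels the
  -- weight of `ω`.
  have hpoint : ∀ ω : Outcomes n T, ∏ t, bellProb ψ (ω t) - ∑ x ∈ bad, miss x ω ≤
      if Outputs cutProgram ω P then ∏ t, bellProb ψ (ω t) else 0 := by
    intro ω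
    split_ifs with hout
    · exact sub_le_self _ (Finset.sum_nonneg fun x _ => hmiss0 x ω)
    · rw [sub_nonpos]
      by_cases h0 : ∏ t, bellProb ψ (ω t) = 0
      · rw [h0]
        exact Finset.sum_nonneg fun x _ => hmiss0 x ω
      · have hgood : ∀ x, (∃ F ⊆ P.parts, zsupport x = F.biUnion id) →
            ∀ t, singletPattern (ω t) ⬝ᵥ x = 0 := by
          intro x hx t
          by_contra hs
          exact h0 (Finset.prod_eq_zero (Finset.mem_univ t)
            (bellProb_eq_zero h.1 (purity_eq_one_of_union h hx) hs))
        obtain ⟨x, hx0, hx⟩ : ∃ x, (∀ t, singletPattern (ω t) ⬝ᵥ x = 0) ∧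
            ¬ ∃ F ⊆ P.parts, zsupport x = F.biUnion id := by
          by_contra! hcon
          exact hout (outputs_cutProgram fun x => ⟨hcon x, hgood x⟩)
        have hle := Finset.single_le_sum (f := fun x => miss x ω) (fun x _ => hmiss0 x ω)
          (show x ∈ bad by simpa [hbad] using hx)
        simp only [hmiss] at hle ⊢
        rwa [if_pos hx0] at hle
  have htotal : ∑ ω : Outcomes n T, ∏ t, bellProb ψ (ω t) = 1 := by
    rw [← Fintype.sum_pow, sum_bellProb h.1, one_pow]
  have hx : ∀ x ∈ bad, ∑ ω, miss x ω ≤ (1 - ε ^ 2 / 2) ^ T := by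
    intro x hx
    -- By independence of the rounds, the sum of products is a `T`-th power.
    have h1 : ∑ ω, miss x ω = ((1 + purity ψ (zsupport x)) / 2) ^ T := by
      rw [← sum_bellProb_filter h.1, Fintype.sum_pow]
      refine Finset.sum_congr rfl fun ω _ => ?_
      rw [Finset.prod_ite_zero]
      simp [hmiss]
    have hp := purity_le_of_not_union hε h (Finset.mem_filter.1 hx).2
    have hp0 := purity_nonneg ψ (zsupport x)
    rw [h1]
    exact pow_le_pow_left₀ (by linarith) (by linarith) T
  have hsum : ∑ ω, ∑ x ∈ bad, miss x ω ≤ 2 ^ n * (1 - ε ^ 2 / 2) ^ T := by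
    rw [Finset.sum_comm]
    refine (Finset.sum_le_card_nsmul _ _ _ hx).trans ?_
    rw [nsmul_eq_mul]
    refine mul_le_mul_of_nonneg_right ?_ (pow_nonneg (by nlinarith) T)
    have := bad.card_le_univ
    rw [Fintype.card_fun, ZMod.card, Fintype.card_fin] at this
    exact_mod_cast this
  calc 1 - 2 ^ n * (1 - ε ^ 2 / 2) ^ T
      ≤ ∑ ω : Outcomes n T, (∏ t, bellProb ψ (ω t) - ∑ x ∈ bad, miss x ω) := by
        rw [Finset.sum_sub_distrib, htotal]
        linarith
    _ ≤ successProb cutProgram T ψ P := Finset.sum_le_sum fun ω _ => hpoint ω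

end Probability

/-! ### The number of rounds. -/

section Rounds

variable {n : ℕ} {ε δ : ℝ}

theorem two_mul_rounds_le (hn : 1 ≤ n) (hε : 0 < ε) (hε1 : ε ≤ 1) (hδ : 0 < δ) (hδ1 : δ < 1) :
    (2 * rounds 2 n ε δ : ℝ) ≤ 6 * (n + Real.log (1 / δ)) / ε ^ 2 := by
  have hlog : 0 ≤ Real.log (1 / δ) := Real.log_nonneg (by rw [le_div_iff₀ hδ]; linarith)
  have hn' : (1 : ℝ) ≤ n := by exact_mod_cast hn
  have hε2 : 0 < ε ^ 2 := by positivity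
  have hε3 : ε ^ 2 ≤ 1 := pow_le_one₀ hε.le hε1
  have h1 : (rounds 2 n ε δ : ℝ) < 2 * (n + Real.log (1 / δ)) / ε ^ 2 + 1 :=
    Nat.ceil_lt_add_one (by positivity)
  -- With `X` for this quotient, `X ≥ 1` absorbs the rounding: `2 (2 X + 1) ≤ 6 X`, whence the
  -- constant `6`.
  have h2 : 1 ≤ (n + Real.log (1 / δ)) / ε ^ 2 := by
    rw [le_div_iff₀ hε2]
    linarith
  rw [mul_div_assoc] at h1 ⊢
  linarith

/-- By `1 - t ≤ exp (-t)`, the constant `c = 2` bounds the power by `exp (-n) δ`, and `2 ≤ e` lets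
`exp (-n)` absorb the `2 ^ n` of the union bound. -/
theorem two_pow_mul_pow_rounds_le (hε : 0 < ε) (hε1 : ε ≤ 1) (hδ : 0 < δ) :
    2 ^ n * (1 - ε ^ 2 / 2) ^ rounds 2 n ε δ ≤ δ := by
  have hε2 : 0 < ε ^ 2 := by positivity
  have hε3 : ε ^ 2 ≤ 1 := pow_le_one₀ hε.le hε1
  have h1 : 2 * (n + Real.log (1 / δ)) / ε ^ 2 ≤ rounds 2 n ε δ := Nat.le_ceil _
  rw [div_le_iff₀ hε2] at h1
  have h2 : (1 - ε ^ 2 / 2) ^ rounds 2 n ε δ ≤ Real.exp (-(n + Real.log (1 / δ))) := by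
    calc (1 - ε ^ 2 / 2) ^ rounds 2 n ε δ ≤ Real.exp (-(ε ^ 2 / 2)) ^ rounds 2 n ε δ :=
          pow_le_pow_left₀ (by linarith) (Real.one_sub_le_exp_neg _) _
      _ = Real.exp (rounds 2 n ε δ * -(ε ^ 2 / 2)) := (Real.exp_nat_mul _ _).symm
      _ ≤ _ := Real.exp_le_exp.2 (by linarith)
  have h3 : Real.exp (-(n + Real.log (1 / δ))) = Real.exp (-1) ^ n * δ := by
    rw [one_div, Real.log_inv, ← Real.exp_nat_mul, neg_add, neg_neg, Real.exp_add,
      Real.exp_log hδ, mul_neg_one]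
  have h4 : 2 * Real.exp (-1) ≤ 1 := by
    rw [Real.exp_neg, ← div_eq_mul_inv, div_le_one (Real.exp_pos 1)]
    linarith [Real.add_one_le_exp 1]
  calc 2 ^ n * (1 - ε ^ 2 / 2) ^ rounds 2 n ε δ ≤ 2 ^ n * (Real.exp (-1) ^ n * δ) := by
        rw [← h3]
        gcongr
    _ = (2 * Real.exp (-1)) ^ n * δ := by rw [mul_pow]; ring
    _ ≤ 1 * δ := by
        gcongr
        exact pow_le_one₀ (by positivity) h4
    _ = δ := one_mul δ

end Rounds

end HiddenCut

theorem mainTheorem3 :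
    -- two layers of gates on two copies, without further qubits, measure the Bell basis,
    -- and thereby the character POVM
    (∀ n : ℕ, (HiddenCut.bellCircuit n).depth = 2 ∧
      (∀ s, (HiddenCut.bellCircuit n).effect s = HiddenCut.ketbra (HiddenCut.bellBasis s)) ∧
      (∀ y : Fin n → ZMod 2,
        ∑ s with HiddenCut.singletPattern s = y, (HiddenCut.bellCircuit n).effect s =
          HiddenCut.characterPOVM y)) ∧
    -- the purity gap
    (∀ (n : ℕ) (ε : ℝ) (ψ : HiddenCut.Amp (Fin n))
      (P : Finpartition (Finset.univ : Finset (Fin n))),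
      0 < ε → ε ≤ 1 → HiddenCut.IsHiddenManyCut ε ψ P →
      ∀ S : Finset (Fin n),
        ((∃ F ⊆ P.parts, S = F.biUnion id) → HiddenCut.purity ψ S = 1) ∧
        ((¬ ∃ F ⊆ P.parts, S = F.biUnion id) → HiddenCut.purity ψ S ≤ 1 - ε ^ 2)) ∧
    -- the non-adaptive algorithm
    ∃ (prog : HiddenCut.Prog) (c C : ℝ) (time : Polynomial ℕ),
      (∀ (n T : ℕ) (ω : HiddenCut.Outcomes n T), ∃ σ k,
        HiddenCut.Exec prog (HiddenCut.input ω) σ k ∧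
          HiddenCut.runtime n T k ≤ time.eval (n + T)) ∧
      ∀ (n : ℕ) (ε δ : ℝ), 1 ≤ n → 0 < ε → ε ≤ 1 → 0 < δ → δ < 1 →
        (2 * HiddenCut.rounds c n ε δ : ℝ) ≤ C * (n + Real.log (1 / δ)) / ε ^ 2 ∧
        ∀ (ψ : HiddenCut.Amp (Fin n)) (P : Finpartition (Finset.univ : Finset (Fin n))),
          HiddenCut.IsHiddenManyCut ε ψ P →
            1 - δ ≤ HiddenCut.successProb prog (HiddenCut.rounds c n ε δ) ψ P := by
  refine ⟨fun n => ⟨HiddenCut.bellCircuit_depth, HiddenCut.bellCircuit_effect,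
    HiddenCut.sum_effect_eq_characterPOVM⟩, fun n ε ψ P hε _ h S =>
    ⟨HiddenCut.purity_eq_one_of_union h, HiddenCut.purity_le_of_not_union hε h⟩, ?_⟩
  obtain ⟨time, htime⟩ := HiddenCut.exists_time_bound
  refine ⟨HiddenCut.cutProgram, 2, 6, time, fun n T ω => ?_, fun n ε δ hn hε hε1 hδ hδ1 =>
    ⟨HiddenCut.two_mul_rounds_le hn hε hε1 hδ hδ1, fun ψ P h => ?_⟩⟩
  · obtain ⟨σ, k, hk, hkt, _⟩ := HiddenCut.haltsWith_cutProgram ω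
    exact ⟨σ, k, hk, htime n T k hkt⟩
  · refine le_trans ?_ (HiddenCut.one_sub_le_successProb hε hε1 h)
    exact sub_le_sub_left (HiddenCut.two_pow_mul_pow_rounds_le hε hε1 hδ) 1
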